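/- **Theorem (symmetry of the LSD of random commutator matrices).** For each $n$ let $p=p(n)$ and let $Z_1=Z_1^{(n)}$, $Z_2=Z_2^{(n)}$ be random complex $p\times n$ matrices with entries $z^{(k)}_{ij}$. Let $\Sigma_{1n},\Sigma_{2n}$ be random positive semi-definite $p\times p$ complex matrices such that the pair $(\Sigma_{1n},\Sigma_{2n})$ is independent of the pair $(Z_1,Z_2)$. Put $$S_n=\frac1n\left(X_1X_2^*-X_2X_1^*\right),\qquad X_k=\Sigma_{kn}^{1/2}Z_k .$$ Assume: 1. $p/n\to c\in(0,\infty)$. 2. For each $n$, the entries of $Z_1$ and $Z_2$ are jointly independent, with $\mathbb E z^{(k)}_{ij}=0$ and $\mathbb E|z^{(k)}_{ij}|^2=1$, and for some $\eta_0>0$, $\sup_{n,k,i,j}\mathbb E|z^{(k)}_{ij}|^{2+\eta_0}<\infty$. 3. Almost surely, $\Sigma_{1n}\Sigma_{2n}=\Sigma_{2n}\Sigma_{1n}$ for all $n$. 4. Let $H_n=\frac1p\sum_{j=1}^p\delta_{(\lambda^{(1)}_j,\lambda^{(2)}_j)}$ be the joint empirical spectral distribution of $(\Sigma_{1n},\Sigma_{2n})$,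 where $\Sigma_{kn}=P\,\mathrm{diag}(\lambda^{(k)}_1,\dots,\lambda^{(k)}_p)P^*$ for a common unitary $P$. Almost surely $H_n$ converges weakly to a non-random probability measure $H$ on $[0,\infty)^2$ whose support is contained in neither of the two coordinate axes. 5. There is a constant $D_0>0$ such that, almost surely, $\limsup_{n\to\infty}\frac1p\operatorname{trace}(\Sigma_{kn}^2)<D_0$ for $k=1,2$. Let $F$ be the limiting spectral distribution (LSD) of $S_n$, i.e. the non-random probability measure (carried by the imaginary axis) to which, almost surely, the empirical spectral distribution of $S_n$ (mass $1/p$ at each eigenvalue, counted with multiplicity) converges weakly. Then $F$ is symmetric about $0$: $F(-B)=F(B)$ for every Borel set $B$. -/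

import Mathlib

open MeasureTheory ProbabilityTheory Filter Topology
open scoped NNReal ENNReal Matrix ComplexOrder

namespace RandomCommutator

/-- The probability measure giving equal mass to the entries of a finite multiset, counted with
multiplicity (the zero measure for the empty multiset). -/
noncomputable def empiricalMeasure {E : Type*} [MeasurableSpace E] (s : Multiset E) :
    FiniteMeasure E :=
  (s.card : ℝ≥0)⁻¹ • (s.map fun x => (diracProba x).toFiniteMeasure).sum

/-- Empirical spectral distribution of a square complex matrix: equal mass on each eigenvalue,
counted with algebraic multiplicity. It lives on `ℂ`; for a skew-Hermitian matrix it is carried by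
the imaginary axis. -/
noncomputable def esd {p : ℕ} (A : Matrix (Fin p) (Fin p) ℂ) : FiniteMeasure ℂ :=
  empiricalMeasure A.charpoly.roots

/-- `P` is a unitary matrix with `M₁ = P diag(d₁) P*` and `M₂ = P diag(d₂) P*`, the `d`s real. -/
def IsJointDiagonalization {p : ℕ} (M₁ M₂ P : Matrix (Fin p) (Fin p) ℂ) (d₁ d₂ : Fin p → ℝ) :
    Prop :=
  P ∈ Matrix.unitaryGroup (Fin p) ℂ ∧
    M₁ = P * Matrix.diagonal (fun j => (d₁ j : ℂ)) * Pᴴ ∧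
    M₂ = P * Matrix.diagonal (fun j => (d₂ j : ℂ)) * Pᴴ

open Classical in
/-- Joint empirical spectral distribution of two commuting Hermitian matrices: choose a common
unitary diagonalization and give equal mass to the pairs `(d₁ j, d₂ j)`. (Junk value `0` if there
is no common diagonalization.) It does not depend on the choice, see `jesd_eq`. -/
noncomputable def jesd {p : ℕ} (M₁ M₂ : Matrix (Fin p) (Fin p) ℂ) : FiniteMeasure (ℝ × ℝ) :=
  if h : ∃ D : Matrix (Fin p) (Fin p) ℂ × (Fin p → ℝ) × (Fin p → ℝ),
      IsJointDiagonalization M₁ M₂ D.1 D.2.1 D.2.2 then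
    empiricalMeasure (Finset.univ.val.map fun j => (h.choose.2.1 j, h.choose.2.2 j))
  else 0

theorem diag_intertwine {p : ℕ} {P Q : Matrix (Fin p) (Fin p) ℂ} {d e : Fin p → ℝ}
    (hP : P ∈ Matrix.unitaryGroup (Fin p) ℂ) (hQ : Q ∈ Matrix.unitaryGroup (Fin p) ℂ)
    (h : P * Matrix.diagonal (fun j => (d j : ℂ)) * Pᴴ
      = Q * Matrix.diagonal (fun j => (e j : ℂ)) * Qᴴ)
    {i j : Fin p} (hij : (Qᴴ * P) i j ≠ 0) : d j = e i := by
  have hP' : Pᴴ * P = 1 := Matrix.mem_unitaryGroup_iff'.1 hP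
  have hQ' : Qᴴ * Q = 1 := Matrix.mem_unitaryGroup_iff'.1 hQ
  have h2 : (Qᴴ * P) * Matrix.diagonal (fun j => (d j : ℂ))
      = Matrix.diagonal (fun j => (e j : ℂ)) * (Qᴴ * P) := by
    calc (Qᴴ * P) * Matrix.diagonal (fun j => (d j : ℂ))
        = Qᴴ * (P * Matrix.diagonal (fun j => (d j : ℂ)) * Pᴴ) * P := by
          simp only [Matrix.mul_assoc, hP', Matrix.mul_one]
      _ = (Qᴴ * Q) * Matrix.diagonal (fun j => (e j : ℂ)) * (Qᴴ * P) := by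
          rw [h]; simp only [Matrix.mul_assoc]
      _ = _ := by rw [hQ', Matrix.one_mul]
  have h3 := congrFun (congrFun h2 i) j
  rw [Matrix.mul_diagonal, Matrix.diagonal_mul, mul_comm] at h3
  exact_mod_cast mul_right_cancel₀ hij h3

theorem jointDiag_unique {p : ℕ} {M₁ M₂ P Q : Matrix (Fin p) (Fin p) ℂ}
    {d₁ d₂ e₁ e₂ : Fin p → ℝ} (hP : IsJointDiagonalization M₁ M₂ P d₁ d₂)
    (hQ : IsJointDiagonalization M₁ M₂ Q e₁ e₂) :
    (Finset.univ.val.map fun j => (d₁ j, d₂ j)) =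
      (Finset.univ.val.map fun j => (e₁ j, e₂ j)) := by
  have hu : Qᴴ * P ∈ Matrix.unitaryGroup (Fin p) ℂ :=
    mul_mem (Unitary.star_mem hQ.1) hP.1
  have hdet : (Qᴴ * P).det ≠ 0 := by
    intro h0
    have := congrArg Matrix.det (Matrix.mem_unitaryGroup_iff.1 hu)
    rw [Matrix.det_mul, h0, zero_mul, Matrix.det_one] at this
    exact zero_ne_one this
  rw [Matrix.det_apply] at hdet
  obtain ⟨σ, -, hσ⟩ := Finset.exists_ne_zero_of_sum_ne_zero hdet
  have hprod : ∏ i, (Qᴴ * P) (σ i) i ≠ 0 := fun h => hσ (by rw [h, smul_zero])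
  have hent : ∀ i, (Qᴴ * P) (σ i) i ≠ 0 := fun i => Finset.prod_ne_zero_iff.1 hprod i (by simp)
  have hfun : (fun j => (d₁ j, d₂ j)) = (fun j => (e₁ j, e₂ j)) ∘ σ := by
    funext j
    exact Prod.ext (diag_intertwine hP.1 hQ.1 (hP.2.1.symm.trans hQ.2.1) (hent j))
      (diag_intertwine hP.1 hQ.1 (hP.2.2.symm.trans hQ.2.2) (hent j))
  rw [hfun]
  rw [← Multiset.map_map, Multiset.map_univ_val_equiv]

/-- The joint empirical spectral distribution may be computed in any common diagonalization. -/
theorem jesd_eq {p : ℕ} {M₁ M₂ P : Matrix (Fin p) (Fin p) ℂ} {d₁ d₂ : Fin p → ℝ}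
    (h : IsJointDiagonalization M₁ M₂ P d₁ d₂) :
    jesd M₁ M₂ = empiricalMeasure (Finset.univ.val.map fun j => (d₁ j, d₂ j)) := by
  have hex : ∃ D : Matrix (Fin p) (Fin p) ℂ × (Fin p → ℝ) × (Fin p → ℝ),
      IsJointDiagonalization M₁ M₂ D.1 D.2.1 D.2.2 := ⟨(P, d₁, d₂), h⟩
  rw [jesd, dif_pos hex, jointDiag_unique hex.choose_spec h]

open scoped MatrixOrder in
/-- The positive semi-definite square root of a positive semi-definite matrix. -/
noncomputable def psdSqrt {p : ℕ} (A : Matrix (Fin p) (Fin p) ℂ) : Matrix (Fin p) (Fin p) ℂ :=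
  CFC.sqrt A

/-- The commutator matrix `n⁻¹ (X₁ X₂* - X₂ X₁*)` with `X_k = Σ_k^{1/2} Z_k`; the index `0` plays
the role of `k = 1` and the index `1` that of `k = 2`. -/
noncomputable def commutatorMatrix {p n : ℕ} (S : Fin 2 → Matrix (Fin p) (Fin p) ℂ)
    (Z : Fin 2 → Matrix (Fin p) (Fin n) ℂ) : Matrix (Fin p) (Fin p) ℂ :=
  (n : ℂ)⁻¹ • ((psdSqrt (S 0) * Z 0) * (psdSqrt (S 1) * Z 1)ᴴ
    - (psdSqrt (S 1) * Z 1) * (psdSqrt (S 0) * Z 0)ᴴ)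

/-- The probability measure `F` is the limiting spectral distribution of the random matrices `A n`:
almost surely, their empirical spectral distributions converge weakly to `F`. -/
def IsLSD {Ω : Type*} [MeasurableSpace Ω] (μ : Measure Ω) {p : ℕ → ℕ}
    (A : (n : ℕ) → Ω → Matrix (Fin (p n)) (Fin (p n)) ℂ) (F : ProbabilityMeasure ℂ) : Prop :=
  ∀ᵐ ω ∂μ, Tendsto (fun n => esd (A n ω)) atTop (𝓝 F.toFiniteMeasure)

end RandomCommutator

/-! Replacing `Z₂` by `-Z₂` turns `S_n` into `-S_n`. If the entries had symmetric laws, symmetry of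
`F` would be immediate; in general the mean of `m_n(s) = p⁻¹ tr (1 - s S_n)⁻¹`, `s` real, is still
asymptotically even in `s`, by a Lindeberg argument that reverses the entries of `Z₂` one at a time.

Condition on the scaling matrices. One entry `t` of `Z₂` enters `s S_n` through a skew-Hermitian
matrix of rank two, real-linear in `t` and of norm at most `2 |t| ‖x‖ ‖a‖`; here `a` is a column of
`Σ₂^{1/2}` and `x` is `s/n` times a column of `X₁`. Comparing `t` with `-t` cancels the even orders
of the resolvent expansion. The linear term has mean zero, and the remainder is bounded by any power
between 2 and 3 of that norm (`exists_linear_approx_trace_inv`), so a moment of order `2q` with `1 <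
q ≤ 3/2` is enough. Because the perturbation has rank two, the trace costs no factor `p`.

`lintegral_enorm_sum_smul_rpow_le` gives columns of `X₁` a `2q`-th moment of order `p^q`, using only
the second spectral moment of `Σ₁`. Summing over all entries of `Z₂`
(`enorm_integral_sub_flipOn_le`) leaves an error of order `(p/n)^q n^(1-q)`, which tends to zero.

Almost sure weak convergence and boundedness give `E m_n(s) → ∫ (1 - i s Im z)⁻¹ dF`, so this
transform of `F` is even. Since `F` lives on the imaginary axis, `ext_of_resolventPower_one` turns
evenness into symmetry. -/

namespace RandomCommutator

/-! ### Resolvents of skew-Hermitian matrices and rank-two perturbations. -/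

section Resolvent

open Matrix
open scoped Matrix.Norms.L2Operator

variable {p : ℕ}

/-- A skew-Hermitian matrix is unitarily diagonalizable with purely imaginary eigenvalues. -/
theorem exists_unitary_diagonal_of_skew {A : Matrix (Fin p) (Fin p) ℂ} (hA : Aᴴ = -A) :
    ∃ U : Matrix (Fin p) (Fin p) ℂ, U ∈ unitaryGroup (Fin p) ℂ ∧ ∃ d : Fin p → ℝ,
      A = U * diagonal (fun i => (d i : ℂ) * Complex.I) * Uᴴ := by
  have hH : ((-Complex.I) • A).IsHermitian := by
    simp [IsHermitian, conjTranspose_smul, hA]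
  refine ⟨hH.eigenvectorUnitary, hH.eigenvectorUnitary.2, hH.eigenvalues, ?_⟩
  have h := hH.spectral_theorem
  rw [Unitary.conjStarAlgAut_apply] at h
  have h2 : A = Complex.I • ((-Complex.I) • A) := by
    rw [smul_smul]; simp
  refine h2.trans ((congrArg (Complex.I • ·) h).trans ?_)
  rw [← Matrix.smul_mul, ← Matrix.mul_smul]
  congr 2
  ext i j
  by_cases hij : i = j
  · subst hij; simp [mul_comm]
  · simp [hij]

theorem inv_one_sub_unitary_conj {U : Matrix (Fin p) (Fin p) ℂ}
    (hU : U ∈ unitaryGroup (Fin p) ℂ) (d : Fin p → ℂ) (hd : ∀ i, 1 - d i ≠ 0) :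
    (1 - U * diagonal d * Uᴴ) * (U * diagonal (fun i => (1 - d i)⁻¹) * Uᴴ) = 1 := by
  have h1 : Uᴴ * U = 1 := mem_unitaryGroup_iff'.1 hU
  have h2 : U * Uᴴ = 1 := mem_unitaryGroup_iff.1 hU
  have h3 : (1 : Matrix (Fin p) (Fin p) ℂ) - U * diagonal d * Uᴴ
      = U * diagonal (fun i => 1 - d i) * Uᴴ := by
    have : diagonal (fun i => 1 - d i) = (1 : Matrix (Fin p) (Fin p) ℂ) - diagonal d := by
      rw [← diagonal_one, diagonal_sub]
    rw [this, mul_sub, sub_mul, mul_one, h2]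
  calc _ = U * diagonal (fun i => 1 - d i) * (Uᴴ * U) * diagonal (fun i => (1 - d i)⁻¹) * Uᴴ := by
        rw [h3]; simp only [Matrix.mul_assoc]
    _ = U * (diagonal (fun i => 1 - d i) * diagonal (fun i => (1 - d i)⁻¹)) * Uᴴ := by
        rw [h1, Matrix.mul_one]; simp only [Matrix.mul_assoc]
    _ = 1 := by
        rw [diagonal_mul_diagonal]
        simp [hd, h2]

theorem one_sub_mul_I_ne_zero (x : ℝ) : (1 : ℂ) - x * Complex.I ≠ 0 := by
  intro h
  simpa using congrArg Complex.re h

theorem one_le_norm_one_sub_mul_I (x : ℝ) : 1 ≤ ‖(1 : ℂ) - x * Complex.I‖ := by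
  simpa using Complex.abs_re_le_norm ((1 : ℂ) - x * Complex.I)

theorem norm_inv_one_sub_mul_I_le (x : ℝ) : ‖((1 : ℂ) - x * Complex.I)⁻¹‖ ≤ 1 := by
  rw [norm_inv]
  exact inv_le_one_of_one_le₀ (one_le_norm_one_sub_mul_I x)

theorem isUnit_one_sub_of_skew {A : Matrix (Fin p) (Fin p) ℂ} (hA : Aᴴ = -A) :
    IsUnit (1 - A).det := by
  obtain ⟨U, hU, d, rfl⟩ := exists_unitary_diagonal_of_skew hA
  exact isUnit_det_of_right_inverse
    (inv_one_sub_unitary_conj hU _ fun i => one_sub_mul_I_ne_zero (d i))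

/-- The spectrum of `1 - A` lies on the line `Re = 1`, at distance at least one from zero. All
resolvent bounds are therefore uniform in the matrices. -/
theorem norm_inv_one_sub_le_of_skew {A : Matrix (Fin p) (Fin p) ℂ} (hA : Aᴴ = -A) :
    ‖(1 - A)⁻¹‖ ≤ 1 := by
  obtain ⟨U, hU, d, rfl⟩ := exists_unitary_diagonal_of_skew hA
  rw [inv_eq_right_inv (inv_one_sub_unitary_conj hU _ fun i => one_sub_mul_I_ne_zero (d i))]
  have h1 := CStarRing.norm_coe_unitary_mul (⟨U, hU⟩ : unitary (Matrix (Fin p) (Fin p) ℂ))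
    (diagonal (fun i => ((1 : ℂ) - d i * Complex.I)⁻¹) * Uᴴ)
  have h2 := CStarRing.norm_mul_coe_unitary
    (diagonal (fun i => ((1 : ℂ) - d i * Complex.I)⁻¹))
    (star (⟨U, hU⟩ : unitary (Matrix (Fin p) (Fin p) ℂ)))
  have h3 : ‖diagonal (fun i => ((1 : ℂ) - d i * Complex.I)⁻¹)‖ ≤ 1 := by
    rw [l2_opNorm_diagonal, pi_norm_le_iff_of_nonneg zero_le_one]
    exact fun i => norm_inv_one_sub_mul_I_le (d i)
  rw [Matrix.mul_assoc]
  exact (h1.trans h2).trans_le h3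

/-- The eigenvalues of a skew-Hermitian matrix are imaginary, and they give the trace of the
resolvent at a real point. -/
theorem exists_roots_charpoly_of_skew {A : Matrix (Fin p) (Fin p) ℂ} (hA : Aᴴ = -A) :
    ∃ d : Fin p → ℝ, A.charpoly.roots = Finset.univ.val.map (fun i => (d i : ℂ) * Complex.I) ∧
      ∀ s : ℝ, ((1 - (s : ℂ) • A)⁻¹).trace = ∑ i, ((1 : ℂ) - ((s * d i : ℝ) : ℂ) * Complex.I)⁻¹ := by
  obtain ⟨U, hU, d, rfl⟩ := exists_unitary_diagonal_of_skew hA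
  have h1 : Uᴴ * U = 1 := mem_unitaryGroup_iff'.1 hU
  refine ⟨d, ?_, fun s => ?_⟩
  · rw [charpoly_mul_comm, ← Matrix.mul_assoc, h1, Matrix.one_mul, charpoly_diagonal]
    exact (congrArg Polynomial.roots (by rw [Multiset.map_map]; rfl)).trans
      (Polynomial.roots_multiset_prod_X_sub_C _)
  · have h2 : (s : ℂ) • (U * diagonal (fun i => (d i : ℂ) * Complex.I) * Uᴴ)
        = U * diagonal (fun i => ((s * d i : ℝ) : ℂ) * Complex.I) * Uᴴ := by
      rw [← Matrix.smul_mul, ← Matrix.mul_smul]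
      congr 2
      ext i j
      by_cases hij : i = j
      · subst hij; simp [mul_assoc]
      · simp [hij]
    rw [h2, inv_eq_right_inv (inv_one_sub_unitary_conj hU _ fun i => one_sub_mul_I_ne_zero _),
      trace_mul_comm, ← Matrix.mul_assoc, h1, Matrix.one_mul, trace_diagonal]

/-- The trace against a rank-one matrix is an inner product, so the operator norm controls it
without a factor `p`. -/
theorem norm_trace_vecMulVec_mul_le (x a : EuclideanSpace ℂ (Fin p))
    (M : Matrix (Fin p) (Fin p) ℂ) :
    ‖(vecMulVec x.ofLp (star a.ofLp) * M).trace‖ ≤ ‖x‖ * ‖a‖ * ‖M‖ := by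
  have h : (vecMulVec x.ofLp (star a.ofLp) * M).trace
      = inner ℂ a (WithLp.toLp 2 (M *ᵥ x.ofLp)) := by
    rw [trace_mul_comm, mul_vecMulVec, trace_vecMulVec, EuclideanSpace.inner_eq_star_dotProduct]
  rw [h]
  calc _ ≤ ‖a‖ * ‖WithLp.toLp 2 (M *ᵥ x.ofLp)‖ := norm_inner_le_norm _ _
    _ ≤ ‖a‖ * (‖M‖ * ‖x‖) := by gcongr; exact l2_opNorm_mulVec M x
    _ = _ := by ring

theorem norm_vecMulVec_le (x a : EuclideanSpace ℂ (Fin p)) :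
    ‖vecMulVec x.ofLp (star a.ofLp)‖ ≤ ‖x‖ * ‖a‖ := by
  rw [cstar_norm_def]
  refine ContinuousLinearMap.opNorm_le_bound _ (by positivity) fun v => ?_
  have h : toEuclideanCLM (n := Fin p) (𝕜 := ℂ) (vecMulVec x.ofLp (star a.ofLp)) v
      = (inner ℂ a v) • x := by
    apply PiLp.ext
    intro i
    simp only [ofLp_toEuclideanCLM, vecMulVec_mulVec, PiLp.smul_apply, Pi.smul_apply,
      EuclideanSpace.inner_eq_star_dotProduct, dotProduct_comm v.ofLp]
    simp [mul_comm]
  rw [h, norm_smul]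
  calc _ ≤ ‖a‖ * ‖v‖ * ‖x‖ := by gcongr; exact norm_inner_le_norm _ _
    _ = _ := by ring

/-- The skew-Hermitian matrix of rank two by which one entry `t` of `Z₂` enters the commutator. -/
noncomputable def rankTwo (x a : EuclideanSpace ℂ (Fin p)) (t : ℂ) :
    Matrix (Fin p) (Fin p) ℂ :=
  star t • vecMulVec x.ofLp (star a.ofLp) - t • vecMulVec a.ofLp (star x.ofLp)

theorem rankTwo_skew (x a : EuclideanSpace ℂ (Fin p)) (t : ℂ) :
    (rankTwo x a t)ᴴ = -rankTwo x a t := by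
  simp [rankTwo, conjTranspose_sub, conjTranspose_smul, conjTranspose_vecMulVec]

theorem rankTwo_neg (x a : EuclideanSpace ℂ (Fin p)) (t : ℂ) :
    rankTwo x a (-t) = -rankTwo x a t := by
  simp only [rankTwo, star_neg, neg_smul]; abel

theorem norm_rankTwo_le (x a : EuclideanSpace ℂ (Fin p)) (t : ℂ) :
    ‖rankTwo x a t‖ ≤ 2 * ‖t‖ * ‖x‖ * ‖a‖ := by
  refine (norm_sub_le _ _).trans ?_
  rw [norm_smul, norm_smul, norm_star]
  calc _ ≤ ‖t‖ * (‖x‖ * ‖a‖) + ‖t‖ * (‖a‖ * ‖x‖) := by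
        gcongr <;> exact norm_vecMulVec_le _ _
    _ = _ := by ring

theorem norm_trace_rankTwo_mul_le (x a : EuclideanSpace ℂ (Fin p)) (t : ℂ)
    (M : Matrix (Fin p) (Fin p) ℂ) :
    ‖(rankTwo x a t * M).trace‖ ≤ 2 * ‖t‖ * ‖x‖ * ‖a‖ * ‖M‖ := by
  rw [rankTwo, sub_mul, trace_sub, Matrix.smul_mul, Matrix.smul_mul, trace_smul, trace_smul]
  refine (norm_sub_le _ _).trans ?_
  rw [norm_smul, norm_smul, norm_star]
  calc _ ≤ ‖t‖ * (‖x‖ * ‖a‖ * ‖M‖) + ‖t‖ * (‖a‖ * ‖x‖ * ‖M‖) := by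
        gcongr <;> exact norm_trace_vecMulVec_mul_le _ _ _
    _ = _ := by ring

/-- Second order expansion of the difference of two resolvents at opposite perturbations. -/
theorem inv_sub_inv_expansion {A D : Matrix (Fin p) (Fin p) ℂ} (h0 : IsUnit (1 - A).det)
    (h1 : IsUnit (1 - (A + D)).det) (h2 : IsUnit (1 - (A - D)).det) :
    (1 - (A + D))⁻¹ - (1 - (A - D))⁻¹
      = (1 - A)⁻¹ * D * ((1 - (A + D))⁻¹ + (1 - (A - D))⁻¹) ∧
    (1 - (A + D))⁻¹ - (1 - (A - D))⁻¹ = (2 : ℂ) • ((1 - A)⁻¹ * D * (1 - A)⁻¹)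
      + (1 - A)⁻¹ * D * (1 - A)⁻¹ * D * ((1 - (A + D))⁻¹ - (1 - (A - D))⁻¹) := by
  set G := (1 - A)⁻¹
  set P := (1 - (A + D))⁻¹
  set N := (1 - (A - D))⁻¹
  have hG : G * (1 - A) = 1 := nonsing_inv_mul _ h0
  have hP : (1 - (A + D)) * P = 1 := mul_nonsing_inv _ h1
  have hN : (1 - (A - D)) * N = 1 := mul_nonsing_inv _ h2
  have eP : P = G + G * D * P := by
    calc P = G * (1 - A) * P := by rw [hG, Matrix.one_mul]
      _ = G * ((1 - (A + D)) * P) + G * D * P := by noncomm_ring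
      _ = _ := by rw [hP, Matrix.mul_one]
  have eN : N = G - G * D * N := by
    calc N = G * (1 - A) * N := by rw [hG, Matrix.one_mul]
      _ = G * ((1 - (A - D)) * N) - G * D * N := by noncomm_ring
      _ = _ := by rw [hN, Matrix.mul_one]
  -- The opposite signs of `D` express the difference through the sum and the sum through the
  -- difference; one substitution then leaves no term quadratic in `D` and `G` alone.
  have e1 : P - N = G * D * (P + N) := by
    nth_rewrite 1 [eP, eN]; noncomm_ring
  have e2 : P + N = (2 : ℂ) • G + G * D * (P - N) := by
    nth_rewrite 1 [eP, eN]; rw [two_smul]; noncomm_ring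
  refine ⟨e1, ?_⟩
  nth_rewrite 1 [e1]
  rw [e2, Matrix.mul_add, Matrix.mul_smul]
  simp only [Matrix.mul_assoc]

/-- Interpolates between the cubic bound for small `δ` and the quadratic one for large `δ`, so that
fewer than three moments suffice. -/
theorem mul_min_le_rpow {δ r : ℝ} (hδ : 0 ≤ δ) (hr2 : 2 ≤ r) (hr3 : r ≤ 3) :
    δ * (δ * min 1 δ) ≤ δ ^ r := by
  rcases le_total δ 1 with h | h
  · rw [min_eq_right h]
    calc δ * (δ * δ) = δ ^ (3 : ℝ) := by norm_cast; ring
      _ ≤ δ ^ r := Real.rpow_le_rpow_of_exponent_ge_of_imp hδ h hr3 (by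
          intro _ h; linarith)
  · rw [min_eq_left h]
    calc δ * (δ * 1) = δ ^ (2 : ℝ) := by norm_cast; ring
      _ ≤ δ ^ r := Real.rpow_le_rpow_of_exponent_le h hr2

/-- Reversing the sign of one entry changes the trace of the resolvent by a term that is
real-linear in the entry, up to an error of order `2 ≤ r ≤ 3`. -/
theorem exists_linear_approx_trace_inv {A : Matrix (Fin p) (Fin p) ℂ} (hA : Aᴴ = -A)
    (x a : EuclideanSpace ℂ (Fin p)) {r : ℝ} (hr2 : 2 ≤ r) (hr3 : r ≤ 3) :
    ∃ α β : ℂ, ∀ t : ℂ,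
      ‖((1 - (A + rankTwo x a t))⁻¹).trace - ((1 - (A + rankTwo x a (-t)))⁻¹).trace
        - (α * t + β * star t)‖ ≤ 2 * (2 * ‖t‖ * ‖x‖ * ‖a‖) ^ r := by
  set G := (1 - A)⁻¹ with hG
  -- The coefficients of `t` and `star t` in `tr (2 G D G)`.
  refine ⟨-(2 * (G * vecMulVec a.ofLp (star x.ofLp) * G).trace),
    2 * (G * vecMulVec x.ofLp (star a.ofLp) * G).trace, fun t => ?_⟩
  set D := rankTwo x a t with hD
  have hDs : Dᴴ = -D := rankTwo_skew x a t
  have hAp : (A + D)ᴴ = -(A + D) := by rw [conjTranspose_add, hA, hDs]; abel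
  have hAm : (A - D)ᴴ = -(A - D) := by rw [conjTranspose_sub, hA, hDs]; abel
  rw [rankTwo_neg, ← sub_eq_add_neg]
  obtain ⟨e1, e2⟩ := inv_sub_inv_expansion (isUnit_one_sub_of_skew hA)
    (isUnit_one_sub_of_skew hAp) (isUnit_one_sub_of_skew hAm)
  have nG : ‖G‖ ≤ 1 := norm_inv_one_sub_le_of_skew hA
  have nP := norm_inv_one_sub_le_of_skew hAp
  have nN := norm_inv_one_sub_le_of_skew hAm
  set P := (1 - (A + D))⁻¹
  set N := (1 - (A - D))⁻¹
  rw [← hG] at e1 e2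
  set δ := 2 * ‖t‖ * ‖x‖ * ‖a‖ with hδ
  have hδ0 : 0 ≤ δ := by positivity
  have nD : ‖D‖ ≤ δ := norm_rankTwo_le x a t
  have lin : ((2 : ℂ) • (G * D * G)).trace
      = -(2 * (G * vecMulVec a.ofLp (star x.ofLp) * G).trace) * t
        + 2 * (G * vecMulVec x.ofLp (star a.ofLp) * G).trace * star t := by
    rw [hD, rankTwo, mul_sub, sub_mul, smul_sub, trace_sub, Matrix.mul_smul, Matrix.mul_smul,
      Matrix.smul_mul, Matrix.smul_mul]
    simp only [trace_smul, smul_eq_mul]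
    ring
  -- Cycling `G` to the end puts the rank-two `D` in front, ready for `norm_trace_rankTwo_mul_le`.
  have key : P.trace - N.trace - (-(2 * (G * vecMulVec a.ofLp (star x.ofLp) * G).trace) * t
      + 2 * (G * vecMulVec x.ofLp (star a.ofLp) * G).trace * star t)
      = (D * (G * D * (P - N) * G)).trace := by
    rw [← lin, ← trace_sub, ← trace_sub, e2, add_sub_cancel_left]
    rw [← e2, Matrix.mul_assoc G D, Matrix.mul_assoc G (D * G), Matrix.mul_assoc G,
      trace_mul_comm G]
    simp only [Matrix.mul_assoc]
  rw [key]
  -- The bound 2 comes from the two resolvents separately, the bound `2 δ` from `e1`.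
  have nPN : ‖P - N‖ ≤ 2 * min 1 δ := by
    rw [mul_min_of_nonneg _ _ (by norm_num : (0 : ℝ) ≤ 2)]
    refine le_min ((norm_sub_le _ _).trans (by linarith)) ?_
    rw [e1]
    calc ‖G * D * (P + N)‖ ≤ ‖G‖ * ‖D‖ * ‖P + N‖ :=
          (norm_mul_le _ _).trans (by gcongr; exact norm_mul_le _ _)
      _ ≤ 1 * δ * (1 + 1) := by
          gcongr
          exact (norm_add_le _ _).trans (by linarith)
      _ = 2 * δ := by ring
  have nM : ‖G * D * (P - N) * G‖ ≤ δ * (2 * min 1 δ) := by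
    calc ‖G * D * (P - N) * G‖ ≤ ‖G‖ * ‖D‖ * ‖P - N‖ * ‖G‖ :=
          (norm_mul_le _ _).trans (by
            gcongr
            exact (norm_mul_le _ _).trans (by gcongr; exact norm_mul_le _ _))
      _ ≤ 1 * δ * (2 * min 1 δ) * 1 := by gcongr
      _ = _ := by ring
  calc _ ≤ δ * ‖G * D * (P - N) * G‖ := norm_trace_rankTwo_mul_le x a t _
    _ ≤ δ * (δ * (2 * min 1 δ)) := by gcongr
    _ = 2 * (δ * (δ * min 1 δ)) := by ring
    _ ≤ 2 * δ ^ r := by gcongr; exact mul_min_le_rpow hδ0 hr2 hr3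

theorem norm_trace_inv_one_sub_le_of_skew {A : Matrix (Fin p) (Fin p) ℂ} (hA : Aᴴ = -A) (s : ℝ) :
    ‖(p : ℂ)⁻¹ * ((1 - (s : ℂ) • A)⁻¹).trace‖ ≤ 1 := by
  obtain ⟨d, -, h⟩ := exists_roots_charpoly_of_skew hA
  rw [h s, norm_mul, norm_inv, Complex.norm_natCast]
  have : ‖∑ i, ((1 : ℂ) - ((s * d i : ℝ) : ℂ) * Complex.I)⁻¹‖ ≤ p := by
    refine (norm_sum_le_of_le _ fun i _ => norm_inv_one_sub_mul_I_le (s * d i)).trans ?_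
    simp
  calc _ ≤ (p : ℝ)⁻¹ * p := by gcongr
    _ ≤ 1 := inv_mul_le_one

end Resolvent

/-! ### Sign reversal of independent coordinates, one at a time. -/

section Lindeberg

variable {ι : Type*} [DecidableEq ι]

/-- Reverse the sign of the coordinates in `T`. -/
def flipOn (T : Finset ι) (z : ι → ℂ) : ι → ℂ := fun i => if i ∈ T then -z i else z i

theorem measurable_flipOn (T : Finset ι) : Measurable (flipOn T) := by
  refine measurable_pi_lambda _ fun i => ?_
  by_cases h : i ∈ T <;> simp only [flipOn, h, if_true, if_false] <;> fun_prop

theorem flipOn_update_of_notMem {T : Finset ι} {i : ι} (hi : i ∉ T) (z : ι → ℂ) (t : ℂ) :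
    flipOn T (Function.update z i t) = Function.update (flipOn T z) i t := by
  funext j
  by_cases h : j = i
  · subst h; simp [flipOn, hi]
  · simp [flipOn, h]

theorem flipOn_insert_update {T : Finset ι} {i : ι} (hi : i ∉ T) (z : ι → ℂ) (t : ℂ) :
    flipOn (insert i T) (Function.update z i t) = Function.update (flipOn T z) i (-t) := by
  funext j
  by_cases h : j = i
  · subst h; simp [flipOn]
  · simp [flipOn, h]

variable [Fintype ι]

/-- Resampling one coordinate preserves a product probability measure. -/
theorem measurePreserving_update_pi (ν : ι → Measure ℂ) [∀ i, IsProbabilityMeasure (ν i)] (i : ι) :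
    MeasurePreserving (fun q : (ι → ℂ) × ℂ => Function.update q.1 i q.2)
      ((Measure.pi ν).prod (ν i)) (Measure.pi ν) := by
  have hm : Measurable fun q : (ι → ℂ) × ℂ => Function.update q.1 i q.2 := by
    refine measurable_pi_lambda _ fun j => ?_
    by_cases h : j = i
    · subst h; simpa using measurable_snd
    · simp only [Function.update_of_ne h]; fun_prop
  refine ⟨hm, (Measure.pi_eq fun s hs => ?_).symm⟩
  rw [Measure.map_apply hm (MeasurableSet.univ_pi hs)]
  -- The old `i`-th coordinate is unconstrained and contributes a factor one; the new one supplies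
  -- `ν i (s i)`.
  have : (fun q : (ι → ℂ) × ℂ => Function.update q.1 i q.2) ⁻¹' Set.univ.pi s
      = (Set.univ.pi (Function.update s i Set.univ)) ×ˢ s i := by
    ext q
    simp only [Set.mem_preimage, Set.mem_pi, Set.mem_univ, true_implies, Set.mem_prod]
    constructor
    · refine fun h => ⟨fun j => ?_, by simpa using h i⟩
      by_cases hj : j = i
      · subst hj; simp
      · simpa [hj] using h j
    · rintro ⟨h1, h2⟩ j
      by_cases hj : j = i
      · subst hj; simpa using h2
      · simpa [hj] using h1 j
  rw [this, Measure.prod_prod, Measure.pi_pi,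
    ← Finset.mul_prod_erase _ _ (Finset.mem_univ i),
    ← Finset.mul_prod_erase _ (fun j => ν j (s j)) (Finset.mem_univ i), mul_comm]
  simp only [Function.update_self, measure_univ, one_mul]
  congr 1
  refine Finset.prod_congr rfl fun j hj => ?_
  rw [Function.update_of_ne (Finset.ne_of_mem_erase hj)]

/-- **Lindeberg replacement** for sign reversals: if reversing a single coordinate changes the
conditional mean of `Φ` by at most `B i`, then reversing all coordinates in `T` changes the mean by
at most the sum of the means of the `B i`. -/
theorem enorm_integral_sub_flipOn_le (ν : ι → Measure ℂ) [∀ i, IsProbabilityMeasure (ν i)]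
    {Φ : (ι → ℂ) → ℂ} (hΦ : Measurable Φ) {C : ℝ} (hC : ∀ z, ‖Φ z‖ ≤ C)
    (B : ι → (ι → ℂ) → ℝ≥0∞) (T : Finset ι)
    (hB : ∀ i ∈ T, ∀ z, ‖∫ t, (Φ (Function.update z i t) - Φ (Function.update z i (-t))) ∂ν i‖ₑ
      ≤ B i z)
    (hBf : ∀ i ∈ T, ∀ U ⊆ T, ∀ z, B i (flipOn U z) = B i z) :
    ‖∫ z, (Φ z - Φ (flipOn T z)) ∂Measure.pi ν‖ₑ ≤ ∑ i ∈ T, ∫⁻ z, B i z ∂Measure.pi ν := by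
  have hint : ∀ f : (ι → ℂ) → (ι → ℂ), Measurable f →
      Integrable (fun z => Φ (f z)) (Measure.pi ν) := fun f hf =>
    Integrable.of_bound (hΦ.comp hf).aestronglyMeasurable C (ae_of_all _ fun z => hC _)
  suffices H : ∀ U ⊆ T, ‖∫ z, (Φ z - Φ (flipOn U z)) ∂Measure.pi ν‖ₑ
      ≤ ∑ i ∈ U, ∫⁻ z, B i z ∂Measure.pi ν from H T subset_rfl
  intro U
  induction U using Finset.induction_on with
  | empty =>
    intro _
    have : ∀ z : ι → ℂ, flipOn ∅ z = z := fun z => by funext i; simp [flipOn]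
    simp [this]
  | insert i U hi ih =>
    intro hU
    have hUT : U ⊆ T := (Finset.subset_insert i U).trans hU
    have hiT : i ∈ T := hU (Finset.mem_insert_self i U)
    have e1 : ∫ z, (Φ z - Φ (flipOn (insert i U) z)) ∂Measure.pi ν
        = ∫ z, (Φ z - Φ (flipOn U z)) ∂Measure.pi ν
          + ∫ z, (Φ (flipOn U z) - Φ (flipOn (insert i U) z)) ∂Measure.pi ν := by
      have i0 := hint id measurable_id
      have i1 := hint _ (measurable_flipOn U)
      have i2 := hint _ (measurable_flipOn (insert i U))
      simp only [id] at i0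
      rw [integral_sub i0 i2, integral_sub i0 i1, integral_sub i1 i2]
      ring
    have hmp := measurePreserving_update_pi ν i
    have hsub : Integrable (fun z => Φ (flipOn U z) - Φ (flipOn (insert i U) z)) (Measure.pi ν) :=
      (hint _ (measurable_flipOn U)).sub (hint _ (measurable_flipOn _))
    -- Resampling the `i`-th coordinate isolates it as an inner integral, where the two reversals
    -- differ only by `t` against `-t`.
    have e2 : ∫ z, (Φ (flipOn U z) - Φ (flipOn (insert i U) z)) ∂Measure.pi ν
        = ∫ z, ∫ t, (Φ (Function.update (flipOn U z) i t)
          - Φ (Function.update (flipOn U z) i (-t))) ∂ν i ∂Measure.pi ν := by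
      rw [← hmp.map_eq, integral_map hmp.measurable.aemeasurable
        (by rw [hmp.map_eq]; exact hsub.aestronglyMeasurable), integral_prod]
      · simp only [flipOn_update_of_notMem hi, flipOn_insert_update hi, hmp.map_eq]
      · exact (hmp.integrable_comp hsub.aestronglyMeasurable).2 hsub
    rw [e1, Finset.sum_insert hi, add_comm]
    refine (enorm_add_le _ _).trans (add_le_add ?_ (ih hUT))
    rw [e2]
    refine (enorm_integral_le_lintegral_enorm _).trans (lintegral_mono fun z => ?_)
    -- `hB` is used at the partly reversed point, and `hBf` removes the reversal from the bound.
    exact (hB i hiT _).trans (hBf i hiT U hUT z).le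

end Lindeberg

/-! ### Moments of random linear combinations of vectors. -/

section Moments

variable {Ω : Type*} {ι : Type*}

variable {E : Type*} [NormedAddCommGroup E] [InnerProductSpace ℂ E]

/-- The off-diagonal part of the squared norm of a random linear combination. -/
noncomputable def offDiag (z : ι → Ω → ℂ) (b : ι → E) (s : Finset ι) (ω : Ω) : ℝ :=
  ‖∑ l ∈ s, z l ω • b l‖ ^ 2 - ∑ l ∈ s, ‖z l ω‖ ^ 2 * ‖b l‖ ^ 2

/-- The increment is real-linear in `z a` with a coefficient built from the other variables. For
independent centred variables this makes `offDiag` a martingale as indices are added. -/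
theorem offDiag_insert [DecidableEq ι] (z : ι → Ω → ℂ) (b : ι → E) {a : ι} {s : Finset ι} (ha : a ∉ s) (ω : Ω) :
    offDiag z b (insert a s) ω = offDiag z b s ω
      + 2 * (z a ω * star (∑ l ∈ s, z l ω * inner ℂ (b a) (b l))).re := by
  rw [offDiag, offDiag, Finset.sum_insert ha, Finset.sum_insert ha, add_comm (z a ω • b a),
    norm_add_sq (𝕜 := ℂ), norm_smul, mul_pow]
  have : inner ℂ (∑ l ∈ s, z l ω • b l) (z a ω • b a)
      = z a ω * star (∑ l ∈ s, z l ω * inner ℂ (b a) (b l)) := by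
    rw [inner_smul_right, sum_inner, star_sum]
    congr 1
    refine Finset.sum_congr rfl fun l _ => ?_
    rw [inner_smul_left, ← inner_conj_symm (b l) (b a)]
    simp
  rw [this]
  simp only [RCLike.re_to_complex]
  ring

variable [MeasurableSpace Ω] {μ : Measure Ω} {z : ι → Ω → ℂ} [DecidableEq ι]

theorem integrable_and_integral_normSq_sum [IsProbabilityMeasure μ] (hm : ∀ i, Measurable (z i))
    (hind : iIndepFun z μ) (hL2 : ∀ i, MemLp (z i) 2 μ) (h0 : ∀ i, ∫ ω, z i ω ∂μ = 0)
    (h1 : ∀ i, ∫ ω, ‖z i ω‖ ^ 2 ∂μ = 1) (c : ι → ℂ) (s : Finset ι) :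
    MemLp (fun ω => ∑ l ∈ s, z l ω * c l) 2 μ ∧
      ∫ ω, ‖∑ l ∈ s, z l ω * c l‖ ^ 2 ∂μ = ∑ l ∈ s, ‖c l‖ ^ 2 := by
  have hLp : ∀ s : Finset ι, MemLp (fun ω => ∑ l ∈ s, z l ω * c l) 2 μ := fun s =>
    memLp_finsetSum s fun l _ => (hL2 l).mul_const (c l)
  refine ⟨hLp s, ?_⟩
  induction s using Finset.induction_on with
  | empty => simp
  | insert a s ha ih =>
    set Y : Ω → ℂ := fun ω => ∑ l ∈ s, z l ω * c l with hY
    have hsplit : ∀ ω, ‖∑ l ∈ insert a s, z l ω * c l‖ ^ 2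
        = ‖Y ω‖ ^ 2 + 2 * (z a ω * (c a * star (Y ω))).re + ‖z a ω‖ ^ 2 * ‖c a‖ ^ 2 := by
      intro ω
      rw [Finset.sum_insert ha, add_comm, ← Complex.normSq_eq_norm_sq, Complex.normSq_add,
        Complex.normSq_eq_norm_sq, Complex.normSq_eq_norm_sq, norm_mul, mul_pow]
      have : ((Y ω) * (starRingEnd ℂ) (z a ω * c a)).re = (z a ω * (c a * star (Y ω))).re := by
        rw [← Complex.conj_re]
        simp only [map_mul, Complex.conj_conj]
        congr 1
        simp only [Complex.star_def]
        ring
      rw [← hY] at *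
      rw [show (∑ l ∈ s, z l ω * c l) = Y ω from rfl, this]
      ring
    have hI : IndepFun (z a) (fun ω => c a * star (Y ω)) μ := by
      have h := hind.indepFun_finset {a} s (by simpa using ha) hm
      exact h.comp (φ := fun w : ({a} : Finset ι) → ℂ => w ⟨a, by simp⟩)
        (ψ := fun w : s → ℂ => c a * star (∑ l : s, w l * c l)) (by fun_prop) (by fun_prop)
        |>.congr (ae_of_all _ fun ω => rfl) (ae_of_all _ fun ω => by
          simp only [Function.comp, hY]
          rw [Finset.sum_coe_sort s (fun l => z l ω * c l)])
    have hYint : Integrable (fun ω => c a * star (Y ω)) μ :=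
      (((hLp s).star).integrable one_le_two).const_mul _
    have hcross : ∫ ω, (z a ω * (c a * star (Y ω))).re ∂μ = 0 := by
      have h := hI.integral_fun_mul_eq_mul_integral (hm a).aestronglyMeasurable
        hYint.aestronglyMeasurable
      rw [h0 a, zero_mul] at h
      have h2 := integral_re (𝕜 := ℂ) (hI.integrable_mul ((hL2 a).integrable one_le_two) hYint)
      simp only [Pi.mul_apply, RCLike.re_to_complex] at h2
      rw [h2, h, Complex.zero_re]
    have hcrossI : Integrable (fun ω => 2 * (z a ω * (c a * star (Y ω))).re) μ :=
      ((hI.integrable_mul ((hL2 a).integrable one_le_two) hYint).re).const_mul 2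
    simp_rw [hsplit]
    have i1 : Integrable (fun ω => ‖Y ω‖ ^ 2) μ := (hLp s).integrable_norm_pow two_ne_zero
    have i2 : Integrable (fun ω => ‖Y ω‖ ^ 2 + 2 * (z a ω * (c a * star (Y ω))).re) μ :=
      i1.add hcrossI
    rw [integral_add i2 (((hL2 a).integrable_norm_pow two_ne_zero).mul_const _),
      integral_add i1 hcrossI, ih,
      integral_const_mul, hcross, integral_mul_const, h1 a, Finset.sum_insert ha]
    ring

/-- Martingale increments are orthogonal, and each is twice the real part of a product of
independent factors, whence the constant 4. Only distinct variables are multiplied, so second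
moments suffice. -/
theorem memLp_offDiag_and_integral_sq_le [IsProbabilityMeasure μ] (hm : ∀ i, Measurable (z i))
    (hind : iIndepFun z μ) (hL2 : ∀ i, MemLp (z i) 2 μ) (h0 : ∀ i, ∫ ω, z i ω ∂μ = 0)
    (h1 : ∀ i, ∫ ω, ‖z i ω‖ ^ 2 ∂μ = 1) (b : ι → E) (s : Finset ι) :
    MemLp (offDiag z b s) 2 μ ∧
      ∫ ω, offDiag z b s ω ^ 2 ∂μ ≤ 4 * ∑ k ∈ s, ∑ l ∈ s, ‖inner ℂ (b k) (b l)‖ ^ 2 := by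
  induction s using Finset.induction_on with
  | empty =>
    have : offDiag z b ∅ = 0 := by funext ω; simp [offDiag]
    rw [this]
    simp
  | insert a s ha ih =>
    obtain ⟨ihL, ihI⟩ := ih
    obtain ⟨hYL, hYI⟩ := integrable_and_integral_normSq_sum hm hind hL2 h0 h1
      (fun l => inner ℂ (b a) (b l)) s
    set Y : Ω → ℂ := fun ω => ∑ l ∈ s, z l ω * inner ℂ (b a) (b l) with hY
    set D : Ω → ℝ := offDiag z b s with hD
    have hfin := hind.indepFun_finset {a} s (by simpa using ha) hm
    set W : Ω → ℂ := fun ω => z a ω * star (Y ω) with hW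
    have hsum : ∀ (ω : Ω), (∑ l : s, z l ω * inner ℂ (b a) (b l)) = Y ω := fun ω =>
      Finset.sum_coe_sort s (fun l => z l ω * inner ℂ (b a) (b l))
    have hYm : Measurable Y := by fun_prop
    have hI1 : IndepFun (fun ω => ‖z a ω‖ ^ 2) (fun ω => ‖Y ω‖ ^ 2) μ := by
      exact hfin.comp (φ := fun w : ({a} : Finset ι) → ℂ => ‖w ⟨a, by simp⟩‖ ^ 2)
        (ψ := fun w : s → ℂ => ‖∑ l : s, w l * inner ℂ (b a) (b l)‖ ^ 2)
        (by fun_prop) (by fun_prop)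
        |>.congr (ae_of_all _ fun ω => rfl) (ae_of_all _ fun ω => by
          simp only [Function.comp, hsum])
    have hDsum : ∀ ω, ‖∑ l : s, z l ω • b l‖ ^ 2 - ∑ l : s, ‖z l ω‖ ^ 2 * ‖b l‖ ^ 2 = D ω := by
      intro ω
      rw [Finset.sum_coe_sort s (fun l => z l ω • b l),
        Finset.sum_coe_sort s (fun l => ‖z l ω‖ ^ 2 * ‖b l‖ ^ 2)]
      rfl
    have hI2 : IndepFun (z a) (fun ω => (D ω : ℂ) * star (Y ω)) μ := by
      refine hfin.comp (φ := fun w : ({a} : Finset ι) → ℂ => w ⟨a, by simp⟩)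
        (ψ := fun w : s → ℂ => ((‖∑ l : s, w l • b l‖ ^ 2 - ∑ l : s, ‖w l‖ ^ 2 * ‖b l‖ ^ 2 : ℝ) : ℂ)
          * star (∑ l : s, w l * inner ℂ (b a) (b l))) (by fun_prop) ?_
        |>.congr (ae_of_all _ fun ω => rfl) (ae_of_all _ fun ω => by
          simp only [Function.comp, hsum, hDsum])
      refine Continuous.measurable ?_
      fun_prop
    have hWL : MemLp W 2 μ := by
      rw [memLp_two_iff_integrable_sq_norm (by fun_prop)]
      refine (hI1.integrable_mul ((hL2 a).integrable_norm_pow two_ne_zero)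
        (hYL.integrable_norm_pow two_ne_zero)).congr (ae_of_all _ fun ω => ?_)
      simp [hW, mul_pow]
    have hWI : ∫ ω, ‖W ω‖ ^ 2 ∂μ = ∑ l ∈ s, ‖inner ℂ (b a) (b l)‖ ^ 2 := by
      have h := hI1.integral_fun_mul_eq_mul_integral (by fun_prop) (by fun_prop)
      rw [h1 a, one_mul, hYI] at h
      rw [← h]
      refine integral_congr_ae (ae_of_all _ fun ω => ?_)
      simp [hW, mul_pow]
    have hre : MemLp (fun ω => (W ω).re) 2 μ := hWL.re
    have hins : offDiag z b (insert a s) = fun ω => D ω + 2 * (W ω).re := by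
      funext ω; exact offDiag_insert z b ha ω
    have hDYI : Integrable (fun ω => (D ω : ℂ) * star (Y ω)) μ :=
      MemLp.integrable_mul (p := 2) (q := 2) ihL.ofReal hYL.star
    have hcross : ∫ ω, D ω * (W ω).re ∂μ = 0 := by
      have h := hI2.integral_fun_mul_eq_mul_integral (hm a).aestronglyMeasurable
        hDYI.aestronglyMeasurable
      rw [h0 a, zero_mul] at h
      have h2 := integral_re (𝕜 := ℂ) (hI2.integrable_mul ((hL2 a).integrable one_le_two) hDYI)
      simp only [Pi.mul_apply, RCLike.re_to_complex] at h2
      rw [h, Complex.zero_re] at h2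
      rw [← h2]
      refine integral_congr_ae (ae_of_all _ fun ω => ?_)
      simp only [hW]
      rw [show z a ω * ((D ω : ℂ) * star (Y ω)) = (D ω : ℂ) * (z a ω * star (Y ω)) by ring,
        Complex.re_ofReal_mul]
    refine ⟨by rw [hins]; exact ihL.add (hre.const_mul 2), ?_⟩
    rw [hins]
    have e : ∀ ω, (D ω + 2 * (W ω).re) ^ 2 = D ω ^ 2 + 4 * (D ω * (W ω).re) + 4 * (W ω).re ^ 2 :=
      fun ω => by ring
    have hDre : Integrable (fun ω => D ω * (W ω).re) μ := ihL.integrable_mul hre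
    simp_rw [e]
    have i2 : Integrable (fun ω => D ω ^ 2 + 4 * (D ω * (W ω).re)) μ :=
      ihL.integrable_sq.add (hDre.const_mul 4)
    rw [integral_add i2 (hre.integrable_sq.const_mul 4),
      integral_add ihL.integrable_sq (hDre.const_mul 4), integral_const_mul, hcross,
      integral_const_mul]
    have hle : ∫ ω, (W ω).re ^ 2 ∂μ ≤ ∑ l ∈ s, ‖inner ℂ (b a) (b l)‖ ^ 2 := by
      rw [← hWI]
      refine integral_mono hre.integrable_sq (hWL.integrable_norm_pow two_ne_zero) fun ω => ?_
      exact sq_le_sq' (neg_le_of_abs_le (Complex.abs_re_le_norm _))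
        (le_of_abs_le (Complex.abs_re_le_norm _))
    -- The new row of the Gram matrix pays for the increment; the new column and the corner are
    -- discarded.
    have hfinal : ∑ k ∈ s, ∑ l ∈ s, ‖inner ℂ (b k) (b l)‖ ^ 2
        + ∑ l ∈ s, ‖inner ℂ (b a) (b l)‖ ^ 2
        ≤ ∑ k ∈ insert a s, ∑ l ∈ insert a s, ‖inner ℂ (b k) (b l)‖ ^ 2 := by
      rw [Finset.sum_insert ha, add_comm]
      refine add_le_add ?_ (Finset.sum_le_sum fun k _ => ?_) <;>
      · rw [Finset.sum_insert ha]
        exact le_add_of_nonneg_left (by positivity)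
    linarith

/-- A moment bound of order `2 q` with `1 ≤ q ≤ 2` for random linear combinations. -/
theorem lintegral_enorm_sum_smul_rpow_le [IsProbabilityMeasure μ] (hm : ∀ i, Measurable (z i))
    (hind : iIndepFun z μ) (hL2 : ∀ i, MemLp (z i) 2 μ) (h0 : ∀ i, ∫ ω, z i ω ∂μ = 0)
    (h1 : ∀ i, ∫ ω, ‖z i ω‖ ^ 2 ∂μ = 1) {q : ℝ} (hq1 : 1 ≤ q) (hq2 : q ≤ 2) {M : ℝ≥0∞}
    (hM : ∀ i, ∫⁻ ω, ‖z i ω‖ₑ ^ (2 * q) ∂μ ≤ M) (b : ι → E) (s : Finset ι) {V : ℝ} (hV : 0 ≤ V)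
    (hV1 : ∑ l ∈ s, ‖b l‖ ^ 2 ≤ V) (hV2 : ∑ k ∈ s, ∑ l ∈ s, ‖inner ℂ (b k) (b l)‖ ^ 2 ≤ V ^ 2) :
    ∫⁻ ω, ‖∑ l ∈ s, z l ω • b l‖ₑ ^ (2 * q) ∂μ
      ≤ 2 ^ (q - 1) * (M + 2 ^ q) * ENNReal.ofReal V ^ q := by
  have hq0 : 0 < q := by linarith
  obtain ⟨hDL, hDI⟩ := memLp_offDiag_and_integral_sq_le hm hind hL2 h0 h1 b s
  set D := offDiag z b s with hD
  set w : ι → ℝ≥0∞ := fun l => ‖b l‖ₑ ^ 2 with hw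
  have hwV : ∑ l ∈ s, w l ≤ ENNReal.ofReal V := by
    refine le_trans (le_of_eq ?_) (ENNReal.ofReal_le_ofReal hV1)
    rw [ENNReal.ofReal_sum_of_nonneg (fun _ _ => by positivity)]
    refine Finset.sum_congr rfl fun l _ => ?_
    rw [hw, ENNReal.ofReal_pow (norm_nonneg _), ofReal_norm]
  have hpt : ∀ ω, ‖∑ l ∈ s, z l ω • b l‖ₑ ^ (2 * q)
      ≤ 2 ^ (q - 1) * (ENNReal.ofReal V ^ (q - 1) * ∑ l ∈ s, w l * ‖z l ω‖ₑ ^ (2 * q)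
        + ‖D ω‖ₑ ^ q) := by
    intro ω
    have hle : ‖∑ l ∈ s, z l ω • b l‖ₑ ^ 2 ≤ ∑ l ∈ s, w l * ‖z l ω‖ₑ ^ 2 + ‖D ω‖ₑ := by
      have h : ‖∑ l ∈ s, z l ω • b l‖ ^ 2 ≤ ∑ l ∈ s, ‖b l‖ ^ 2 * ‖z l ω‖ ^ 2 + ‖D ω‖ := by
        have : ‖∑ l ∈ s, z l ω • b l‖ ^ 2 = ∑ l ∈ s, ‖b l‖ ^ 2 * ‖z l ω‖ ^ 2 + D ω := by
          simp only [hD, offDiag, mul_comm]; ring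
        rw [this]
        gcongr
        exact Real.le_norm_self _
      have h' := ENNReal.ofReal_le_ofReal h
      rw [ENNReal.ofReal_add (by positivity) (by positivity),
        ENNReal.ofReal_sum_of_nonneg (fun _ _ => by positivity), ENNReal.ofReal_pow (norm_nonneg _),
        ofReal_norm, ofReal_norm] at h'
      refine h'.trans (le_of_eq ?_)
      congr 1
      refine Finset.sum_congr rfl fun l _ => ?_
      rw [ENNReal.ofReal_mul (by positivity), ENNReal.ofReal_pow (norm_nonneg _),
        ENNReal.ofReal_pow (norm_nonneg _), ofReal_norm, ofReal_norm]
    -- Hölder's inequality with weights `‖b l‖ ^ 2`, whose total mass is at most `V`.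
    have hJ : (∑ l ∈ s, w l * ‖z l ω‖ₑ ^ 2) ^ q
        ≤ ENNReal.ofReal V ^ (q - 1) * ∑ l ∈ s, w l * ‖z l ω‖ₑ ^ (2 * q) := by
      have h := ENNReal.rpow_le_rpow
        (ENNReal.inner_le_weight_mul_Lp_of_nonneg s hq1 w (fun l => ‖z l ω‖ₑ ^ 2)) hq0.le
      refine h.trans ?_
      rw [ENNReal.mul_rpow_of_nonneg _ _ hq0.le, ← ENNReal.rpow_mul, ← ENNReal.rpow_mul,
        inv_mul_cancel₀ hq0.ne', ENNReal.rpow_one, sub_mul, inv_mul_cancel₀ hq0.ne', one_mul]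
      gcongr with l _
      rw [← ENNReal.rpow_natCast, ← ENNReal.rpow_mul]
      norm_num
    calc ‖∑ l ∈ s, z l ω • b l‖ₑ ^ (2 * q) = (‖∑ l ∈ s, z l ω • b l‖ₑ ^ 2) ^ q := by
          rw [ENNReal.rpow_mul]; norm_num
      _ ≤ (∑ l ∈ s, w l * ‖z l ω‖ₑ ^ 2 + ‖D ω‖ₑ) ^ q := by gcongr
      _ ≤ 2 ^ (q - 1) * ((∑ l ∈ s, w l * ‖z l ω‖ₑ ^ 2) ^ q + ‖D ω‖ₑ ^ q) :=
          ENNReal.rpow_add_le_mul_rpow_add_rpow _ _ hq1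
      _ ≤ _ := by gcongr
  -- As `q ≤ 2` on a probability space, the `L^q` norm is below the `L²` norm, which is at most `2
  -- V`.
  have hDq : ∫⁻ ω, ‖D ω‖ₑ ^ q ∂μ ≤ 2 ^ q * ENNReal.ofReal V ^ q := by
    have h := eLpNorm'_le_eLpNorm'_of_exponent_le hq0 hq2 μ hDL.aestronglyMeasurable
    have h2 : ∫⁻ ω, ‖D ω‖ₑ ^ (2 : ℝ) ∂μ ≤ (2 * ENNReal.ofReal V) ^ (2 : ℝ) := by
      calc ∫⁻ ω, ‖D ω‖ₑ ^ (2 : ℝ) ∂μ = ∫⁻ ω, ENNReal.ofReal (D ω ^ 2) ∂μ := by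
            refine lintegral_congr fun ω => ?_
            rw [← sq_abs, ENNReal.ofReal_pow (abs_nonneg _), ← Real.norm_eq_abs, ofReal_norm]
            norm_num
        _ = ENNReal.ofReal (∫ ω, D ω ^ 2 ∂μ) :=
            (ofReal_integral_eq_lintegral_ofReal hDL.integrable_sq
              (ae_of_all _ fun ω => sq_nonneg _)).symm
        _ ≤ ENNReal.ofReal ((2 * V) ^ 2) := by
            refine ENNReal.ofReal_le_ofReal (hDI.trans ?_)
            nlinarith
        _ = _ := by
            rw [ENNReal.ofReal_pow (by positivity), ENNReal.ofReal_mul (by norm_num)]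
            norm_num
    rw [eLpNorm'_eq_lintegral_enorm, eLpNorm'_eq_lintegral_enorm] at h
    have h3 := ENNReal.rpow_le_rpow h hq0.le
    rw [← ENNReal.rpow_mul, one_div_mul_cancel hq0.ne', ENNReal.rpow_one] at h3
    refine h3.trans ?_
    rw [← ENNReal.mul_rpow_of_nonneg _ _ hq0.le]
    gcongr
    refine (ENNReal.rpow_le_rpow h2 (by norm_num)).trans (le_of_eq ?_)
    rw [← ENNReal.rpow_mul]; norm_num
  calc ∫⁻ ω, ‖∑ l ∈ s, z l ω • b l‖ₑ ^ (2 * q) ∂μ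
      ≤ ∫⁻ ω, 2 ^ (q - 1) * (ENNReal.ofReal V ^ (q - 1) * ∑ l ∈ s, w l * ‖z l ω‖ₑ ^ (2 * q)
        + ‖D ω‖ₑ ^ q) ∂μ := lintegral_mono hpt
    _ = 2 ^ (q - 1) * (ENNReal.ofReal V ^ (q - 1) * ∑ l ∈ s, w l * ∫⁻ ω, ‖z l ω‖ₑ ^ (2 * q) ∂μ
        + ∫⁻ ω, ‖D ω‖ₑ ^ q ∂μ) := by
        have hzm : ∀ l, Measurable fun ω => ‖z l ω‖ₑ ^ (2 * q) := fun l => by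
          have := hm l; fun_prop
        rw [lintegral_const_mul' _ _ (by finiteness), lintegral_add_left (by fun_prop),
          lintegral_const_mul _ (by fun_prop), lintegral_finsetSum _ (by fun_prop)]
        simp_rw [lintegral_const_mul _ (hzm _)]
    _ ≤ 2 ^ (q - 1) * (ENNReal.ofReal V ^ (q - 1) * (ENNReal.ofReal V * M)
        + 2 ^ q * ENNReal.ofReal V ^ q) := by
        gcongr
        calc _ ≤ ∑ l ∈ s, w l * M := by gcongr with l _; exact hM l
          _ ≤ _ := by rw [← Finset.sum_mul]; gcongr
    _ = _ := by
        have : ENNReal.ofReal V ^ (q - 1) * ENNReal.ofReal V = ENNReal.ofReal V ^ q := by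
          nth_rewrite 2 [← ENNReal.rpow_one (ENNReal.ofReal V)]
          rw [← ENNReal.rpow_add_of_nonneg _ _ (by linarith) zero_le_one, sub_add_cancel]
        rw [← mul_assoc (ENNReal.ofReal V ^ (q - 1)), this]
        ring

end Moments

/-! ### The effect of sign reversals in `Z₂` on the resolvent trace. -/

section Comparison

open Matrix

variable {p n : ℕ}

/-- The `k`-th of the two matrices with the given entries. -/
def entriesMatrix {m n : ℕ} (z : Fin 2 × Fin m × Fin n → ℂ) (k : Fin 2) :
    Matrix (Fin m) (Fin n) ℂ :=
  of fun i j => z (k, i, j)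

/-- The matrix `n⁻¹ (X₁ X₂* - X₂ X₁*)` with `X_k = B_k Z_k`. -/
noncomputable def scaledCommutator (B : Fin 2 → Matrix (Fin p) (Fin p) ℂ)
    (Z : Fin 2 → Matrix (Fin p) (Fin n) ℂ) : Matrix (Fin p) (Fin p) ℂ :=
  (n : ℂ)⁻¹ • ((B 0 * Z 0) * (B 1 * Z 1)ᴴ - (B 1 * Z 1) * (B 0 * Z 0)ᴴ)

theorem scaledCommutator_skew (B : Fin 2 → Matrix (Fin p) (Fin p) ℂ)
    (Z : Fin 2 → Matrix (Fin p) (Fin n) ℂ) :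
    (scaledCommutator B Z)ᴴ = -scaledCommutator B Z := by
  simp only [scaledCommutator, conjTranspose_smul, conjTranspose_sub, conjTranspose_mul,
    conjTranspose_conjTranspose, Matrix.mul_assoc]
  rw [← smul_neg, neg_sub]
  simp

theorem real_smul_skew {A : Matrix (Fin p) (Fin p) ℂ} (hA : Aᴴ = -A) (s : ℝ) :
    ((s : ℂ) • A)ᴴ = -((s : ℂ) • A) := by
  rw [conjTranspose_smul, hA, smul_neg]; simp

/-- The normalized trace of the resolvent `(1 - s S)⁻¹` of the commutator matrix `S`. -/
noncomputable def resolventMean (s : ℝ) (B : Fin 2 → Matrix (Fin p) (Fin p) ℂ)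
    (Z : Fin 2 → Matrix (Fin p) (Fin n) ℂ) : ℂ :=
  (p : ℂ)⁻¹ * ((1 - (s : ℂ) • scaledCommutator B Z)⁻¹).trace

theorem norm_resolventMean_le (s : ℝ) (B : Fin 2 → Matrix (Fin p) (Fin p) ℂ)
    (Z : Fin 2 → Matrix (Fin p) (Fin n) ℂ) : ‖resolventMean s B Z‖ ≤ 1 :=
  norm_trace_inv_one_sub_le_of_skew (scaledCommutator_skew B Z) s

/-- By Cramer's rule the inverse is the adjugate over a determinant that never vanishes for
skew-Hermitian matrices. Joint continuity yields the measurability needed to condition on the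
scaling matrices. -/
theorem continuous_resolventMean (s : ℝ) :
    Continuous fun q : (Fin 2 × Fin p × Fin p → ℂ) × (Fin 2 × Fin p × Fin n → ℂ) =>
      resolventMean s (entriesMatrix q.1) (entriesMatrix q.2) := by
  have hB : ∀ k, Continuous fun q : (Fin 2 × Fin p × Fin p → ℂ) × (Fin 2 × Fin p × Fin n → ℂ) =>
      entriesMatrix q.1 k := fun k => continuous_matrix fun i j => by
    simp only [entriesMatrix, of_apply]; fun_prop
  have hZ : ∀ k, Continuous fun q : (Fin 2 × Fin p × Fin p → ℂ) × (Fin 2 × Fin p × Fin n → ℂ) =>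
      entriesMatrix q.2 k := fun k => continuous_matrix fun i j => by
    simp only [entriesMatrix, of_apply]; fun_prop
  have hS : Continuous fun q : (Fin 2 × Fin p × Fin p → ℂ) × (Fin 2 × Fin p × Fin n → ℂ) =>
      1 - (s : ℂ) • scaledCommutator (entriesMatrix q.1) (entriesMatrix q.2) := by
    have hX := fun k => (hB k).matrix_mul (hZ k)
    have hC := ((((hX 0).matrix_mul (hX 1).matrix_conjTranspose).sub
      ((hX 1).matrix_mul (hX 0).matrix_conjTranspose)).const_smul (n : ℂ)⁻¹).const_smul (s : ℂ)
    exact continuous_const.sub hC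
  simp only [resolventMean, inv_def, Ring.inverse_eq_inv']
  refine continuous_const.mul (Continuous.matrix_trace ?_)
  refine Continuous.smul (hS.matrix_det.inv₀ fun q => ?_) hS.matrix_adjugate
  exact (isUnit_one_sub_of_skew (real_smul_skew (scaledCommutator_skew _ _) s)).ne_zero

/-- The `i`-th column of a matrix as a Euclidean vector. -/
noncomputable def colVec {m : ℕ} (B : Matrix (Fin p) (Fin m) ℂ) (i : Fin m) :
    EuclideanSpace ℂ (Fin p) :=
  WithLp.toLp 2 fun l => B l i

theorem inner_colVec (B : Matrix (Fin p) (Fin p) ℂ) (k l : Fin p) :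
    inner ℂ (colVec B k) (colVec B l) = (Bᴴ * B) k l := by
  simp [colVec, EuclideanSpace.inner_eq_star_dotProduct, dotProduct, mul_apply, mul_comm]

/-- The entry positions belonging to the second matrix. -/
def secondEntries (p n : ℕ) : Finset (Fin 2 × Fin p × Fin n) := {1} ×ˢ Finset.univ

theorem resolventMean_flipOn (s : ℝ) (B : Fin 2 → Matrix (Fin p) (Fin p) ℂ)
    (z : Fin 2 × Fin p × Fin n → ℂ) :
    resolventMean s B (entriesMatrix (flipOn (secondEntries p n) z))
      = resolventMean (-s) B (entriesMatrix z) := by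
  have h0 : entriesMatrix (flipOn (secondEntries p n) z) 0 = entriesMatrix z 0 := by
    ext i j; simp [entriesMatrix, flipOn, secondEntries]
  have h1 : entriesMatrix (flipOn (secondEntries p n) z) 1 = -entriesMatrix z 1 := by
    ext i j; simp [entriesMatrix, flipOn, secondEntries]
  have h : scaledCommutator B (entriesMatrix (flipOn (secondEntries p n) z))
      = -scaledCommutator B (entriesMatrix z) := by
    simp only [scaledCommutator, h0, h1, Matrix.mul_neg, Matrix.neg_mul, conjTranspose_neg]
    rw [← smul_neg]; congr 1; abel
  rw [resolventMean, resolventMean, h, Complex.ofReal_neg, smul_neg, neg_smul]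

/-- The commutator is real-affine in each entry of `Z₂`: entry `(i, j)` meets only column `j` of
`X₁` and column `i` of `B 1`. -/
theorem smul_scaledCommutator_update (s : ℝ) (B : Fin 2 → Matrix (Fin p) (Fin p) ℂ)
    (z : Fin 2 × Fin p × Fin n → ℂ) (i : Fin p) (j : Fin n) (t : ℂ) :
    (s : ℂ) • scaledCommutator B (entriesMatrix (Function.update z (1, i, j) t))
      = (s : ℂ) • scaledCommutator B (entriesMatrix (Function.update z (1, i, j) 0))
        + rankTwo (((s / n : ℝ) : ℂ) • ∑ k, z (0, k, j) • colVec (B 0) k) (colVec (B 1) i) t := by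
  set X : Matrix (Fin p) (Fin n) ℂ := B 0 * entriesMatrix z 0 with hX
  set W : Matrix (Fin p) (Fin n) ℂ :=
    B 1 * entriesMatrix (Function.update z (1, i, j) 0) 1 with hW
  set y : Matrix (Fin p) (Fin n) ℂ := B 1 * single i j t with hy
  have h0 : ∀ t, entriesMatrix (Function.update z (1, i, j) t) 0 = entriesMatrix z 0 := by
    intro t; ext a b; simp [entriesMatrix]
  have h1 : B 1 * entriesMatrix (Function.update z (1, i, j) t) 1 = W + y := by
    rw [hW, hy, ← Matrix.mul_add]
    congr 1
    ext a b
    by_cases hab : a = i ∧ b = j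
    · obtain ⟨rfl, rfl⟩ := hab; simp [entriesMatrix]
    · have hne : ((1 : Fin 2), a, b) ≠ (1, i, j) := by simpa using hab
      have : ¬ (i = a ∧ j = b) := fun h => hab ⟨h.1.symm, h.2.symm⟩
      simp [entriesMatrix, Function.update_of_ne hne, this]
  have hyapp : ∀ a b, y a b = if b = j then B 1 a i * t else 0 := by
    intro a b
    by_cases hb : b = j
    · subst hb; simp [hy]
    · simp [hy, hb, mul_single_apply_of_ne]
  have hxapp : ∀ a, (∑ k, z (0, k, j) • colVec (B 0) k) a = X a j := by
    intro a
    simp [hX, mul_apply, colVec, entriesMatrix, mul_comm]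
  have hxy : ∀ a b, (X * yᴴ) a b = star t * (X a j * star (B 1 b i)) := by
    intro a b
    simp only [mul_apply, conjTranspose_apply, hyapp]
    rw [Finset.sum_eq_single j (fun c _ hc => by simp [hc]) (by simp)]
    simp; ring
  have hyx : y * Xᴴ = (X * yᴴ)ᴴ := by
    rw [conjTranspose_mul X, conjTranspose_conjTranspose]
  simp only [scaledCommutator, h0, h1, ← hX, ← hW]
  have e : X * (W + y)ᴴ - (W + y) * Xᴴ = (X * Wᴴ - W * Xᴴ) + (X * yᴴ - y * Xᴴ) := by
    rw [conjTranspose_add, Matrix.mul_add, Matrix.add_mul]; abel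
  rw [e, smul_add, smul_add]
  congr 1
  ext a b
  simp only [Matrix.smul_apply, Matrix.sub_apply, hyx, conjTranspose_apply, hxy, rankTwo, vecMulVec_apply,
    Pi.star_apply, PiLp.smul_apply, hxapp, smul_eq_mul]
  simp [colVec]
  ring

/-- A centred law annihilates every real-linear function, so only the approximation error survives;
nothing is asked of `∫ t ^ 2`. -/
theorem enorm_integral_le_of_linear_approx {ν : Measure ℂ} (hν : Integrable (fun t => t) ν)
    (h0 : ∫ t, t ∂ν = 0) {f : ℂ → ℂ} (hf : Integrable f ν) {α β : ℂ} {g : ℂ → ℝ}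
    (hg : ∀ t, ‖f t - (α * t + β * star t)‖ ≤ g t) :
    ‖∫ t, f t ∂ν‖ₑ ≤ ∫⁻ t, ENNReal.ofReal (g t) ∂ν := by
  have hs : Integrable (fun t : ℂ => star t) ν := by
    simpa using (Complex.conjCLE.toContinuousLinearMap).integrable_comp hν
  have hs0 : ∫ t : ℂ, star t ∂ν = 0 := by
    have := integral_conj (𝕜 := ℂ) (f := fun t : ℂ => t) (μ := ν)
    simpa [h0] using this
  have hl : Integrable (fun t : ℂ => α * t + β * star t) ν := (hν.const_mul α).add (hs.const_mul β)
  have hl0 : ∫ t : ℂ, (α * t + β * star t) ∂ν = 0 := by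
    rw [integral_add (hν.const_mul α) (hs.const_mul β), integral_const_mul, integral_const_mul,
      h0, hs0]
    simp
  have e : ∫ t, f t ∂ν = ∫ t, (f t - (α * t + β * star t)) ∂ν := by
    rw [integral_sub hf hl, hl0, sub_zero]
  rw [e]
  refine (enorm_integral_le_lintegral_enorm _).trans (lintegral_mono fun t => ?_)
  rw [← ofReal_norm]
  exact ENNReal.ofReal_le_ofReal (hg t)

theorem continuous_resolventMean_right (s : ℝ) (B : Fin 2 → Matrix (Fin p) (Fin p) ℂ) :
    Continuous fun z : Fin 2 × Fin p × Fin n → ℂ => resolventMean s B (entriesMatrix z) := by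
  set b : Fin 2 × Fin p × Fin p → ℂ := fun x => B x.1 x.2.1 x.2.2
  have hB : entriesMatrix b = B := rfl
  have h := (continuous_resolventMean (n := n) s).comp
    (f := fun z : Fin 2 × Fin p × Fin n → ℂ => (b, z)) (by fun_prop)
  simp only [Function.comp_def, hB] at h
  exact h

/-- The effect on the conditional mean of the normalized trace of reversing one entry. -/
theorem enorm_integral_resolventMean_update_sub_le (s : ℝ)
    (B : Fin 2 → Matrix (Fin p) (Fin p) ℂ) {ν : Measure ℂ} [IsProbabilityMeasure ν]
    (hint : Integrable (fun t => t) ν) (h0 : ∫ t, t ∂ν = 0)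
    {q : ℝ} (hq1 : 1 ≤ q) (hq2 : q ≤ 3 / 2) {M : ℝ≥0∞} (hM : ∫⁻ t, ‖t‖ₑ ^ (2 * q) ∂ν ≤ M)
    (z : Fin 2 × Fin p × Fin n → ℂ) (i : Fin p) (j : Fin n) :
    ‖∫ t, (resolventMean s B (entriesMatrix (Function.update z (1, i, j) t))
        - resolventMean s B (entriesMatrix (Function.update z (1, i, j) (-t)))) ∂ν‖ₑ
      ≤ ENNReal.ofReal ((p : ℝ)⁻¹ * 2 * (2 * |s| / n) ^ (2 * q)) * M
        * (‖colVec (B 1) i‖ₑ ^ (2 * q) * ‖∑ k, z (0, k, j) • colVec (B 0) k‖ₑ ^ (2 * q)) := by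
  have hq0 : 0 ≤ 2 * q := by linarith
  have hcont := continuous_resolventMean_right (n := n) s B
  set K := ENNReal.ofReal ((p : ℝ)⁻¹ * 2 * (2 * |s| / n) ^ (2 * q)) with hK
  -- The expansion is around the matrix with this entry set to zero, so `α` and `β` do not depend on
  -- `t`.
  obtain ⟨α, β, hαβ⟩ := exists_linear_approx_trace_inv
    (real_smul_skew (scaledCommutator_skew B
      (entriesMatrix (Function.update z (1, i, j) 0))) s)
    (((s / n : ℝ) : ℂ) • ∑ k, z (0, k, j) • colVec (B 0) k) (colVec (B 1) i)
    (r := 2 * q) (by linarith) (by linarith)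
  set x := ∑ k, z (0, k, j) • colVec (B 0) k with hxdef
  have hbound : ∀ t : ℂ, ‖(resolventMean s B (entriesMatrix (Function.update z (1, i, j) t))
      - resolventMean s B (entriesMatrix (Function.update z (1, i, j) (-t))))
      - ((p : ℂ)⁻¹ * α * t + (p : ℂ)⁻¹ * β * star t)‖
      ≤ (p : ℝ)⁻¹ * 2 * (2 * |s| / n) ^ (2 * q)
        * (‖colVec (B 1) i‖ ^ (2 * q) * ‖x‖ ^ (2 * q) * ‖t‖ ^ (2 * q)) := by
    intro t
    have h := hαβ t
    simp only [resolventMean]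
    rw [smul_scaledCommutator_update, smul_scaledCommutator_update s B z i j (-t)]
    have e : ∀ u v : ℂ, (p : ℂ)⁻¹ * u - (p : ℂ)⁻¹ * v
        - ((p : ℂ)⁻¹ * α * t + (p : ℂ)⁻¹ * β * star t)
        = (p : ℂ)⁻¹ * (u - v - (α * t + β * star t)) := fun u v => by ring
    rw [e, norm_mul, norm_inv, Complex.norm_natCast]
    calc _ ≤ (p : ℝ)⁻¹ * (2 * (2 * ‖t‖ * ‖((s / n : ℝ) : ℂ) • x‖ * ‖colVec (B 1) i‖) ^ (2 * q)) := by
          gcongr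
      _ = _ := by
          rw [norm_smul, Complex.norm_real, Real.norm_eq_abs, abs_div, Nat.abs_cast,
            show 2 * ‖t‖ * (|s| / n * ‖x‖) * ‖colVec (B 1) i‖
              = (2 * |s| / n) * (‖colVec (B 1) i‖ * ‖x‖ * ‖t‖) by ring,
            Real.mul_rpow (by positivity) (by positivity),
            Real.mul_rpow (by positivity) (by positivity),
            Real.mul_rpow (by positivity) (by positivity)]
          ring
  have hf : ∀ ε : ℂ, Integrable (fun t : ℂ =>
      resolventMean s B (entriesMatrix (Function.update z (1, i, j) (ε * t)))) (ν) :=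
    fun ε => Integrable.of_bound (Continuous.aestronglyMeasurable (hcont.comp
      (continuous_const.update _ (continuous_const.mul continuous_id)))) 1
      (ae_of_all _ fun t => norm_resolventMean_le _ _ _)
  have hf' : Integrable (fun t : ℂ =>
      resolventMean s B (entriesMatrix (Function.update z (1, i, j) t))
      - resolventMean s B (entriesMatrix (Function.update z (1, i, j) (-t)))) (ν) := by
    have := (hf 1).sub (hf (-1))
    simpa [Pi.sub_def] using this
  refine (enorm_integral_le_of_linear_approx hint h0 hf' hbound).trans ?_
  have e : ∀ t : ℂ, ENNReal.ofReal ((p : ℝ)⁻¹ * 2 * (2 * |s| / n) ^ (2 * q)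
        * (‖colVec (B 1) i‖ ^ (2 * q) * ‖x‖ ^ (2 * q) * ‖t‖ ^ (2 * q)))
      = K * (‖colVec (B 1) i‖ₑ ^ (2 * q) * ‖x‖ₑ ^ (2 * q)) * ‖t‖ₑ ^ (2 * q) := by
    intro t
    rw [ENNReal.ofReal_mul (p := (p : ℝ)⁻¹ * 2 * (2 * |s| / n) ^ (2 * q)) (by positivity), ← hK,
      ENNReal.ofReal_mul (by positivity), ENNReal.ofReal_mul (by positivity),
      ← ENNReal.ofReal_rpow_of_nonneg (norm_nonneg _) hq0,
      ← ENNReal.ofReal_rpow_of_nonneg (norm_nonneg _) hq0,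
      ← ENNReal.ofReal_rpow_of_nonneg (norm_nonneg _) hq0, ofReal_norm, ofReal_norm, ofReal_norm]
    ring
  simp_rw [e]
  rw [lintegral_const_mul _ (by fun_prop)]
  calc _ ≤ K * (‖colVec (B 1) i‖ₑ ^ (2 * q) * ‖x‖ₑ ^ (2 * q)) * M := by gcongr
    _ = _ := by ring

/-- For fixed scaling matrices, replacing `Z₂` by `-Z₂` hardly changes the mean of the normalized
trace of the resolvent. -/
theorem enorm_integral_resolventMean_sub_le (s : ℝ) (B : Fin 2 → Matrix (Fin p) (Fin p) ℂ)
    (ν : Fin 2 × Fin p × Fin n → Measure ℂ) [∀ i, IsProbabilityMeasure (ν i)]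
    (hint : ∀ i, Integrable (fun t => t) (ν i)) (h0 : ∀ i, ∫ t, t ∂ν i = 0)
    {q : ℝ} (hq1 : 1 ≤ q) (hq2 : q ≤ 3 / 2) {M R : ℝ≥0∞}
    (hM : ∀ i, ∫⁻ t, ‖t‖ₑ ^ (2 * q) ∂ν i ≤ M)
    (hR : ∀ j, ∫⁻ z, ‖∑ k, z (0, k, j) • colVec (B 0) k‖ₑ ^ (2 * q) ∂Measure.pi ν ≤ R) :
    ‖∫ z, (resolventMean s B (entriesMatrix z) - resolventMean (-s) B (entriesMatrix z))
      ∂Measure.pi ν‖ₑ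
      ≤ ENNReal.ofReal ((p : ℝ)⁻¹ * 2 * (2 * |s| / n) ^ (2 * q)) * M
        * (∑ i, ‖colVec (B 1) i‖ₑ ^ (2 * q)) * (n * R) := by
  have hq0 : 0 ≤ 2 * q := by linarith
  set K := ENNReal.ofReal ((p : ℝ)⁻¹ * 2 * (2 * |s| / n) ^ (2 * q)) with hK
  have hcont := continuous_resolventMean_right (n := n) s B
  set b : Fin 2 × Fin p × Fin n → (Fin 2 × Fin p × Fin n → ℂ) → ℝ≥0∞ := fun x z =>
    K * M * (‖colVec (B 1) x.2.1‖ₑ ^ (2 * q) *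
      ‖∑ k, z (0, k, x.2.2) • colVec (B 0) k‖ₑ ^ (2 * q)) with hb
  have hL := enorm_integral_sub_flipOn_le ν hcont.measurable
    (fun z => norm_resolventMean_le s B (entriesMatrix z)) b (secondEntries p n) ?_ ?_
  · simp only [resolventMean_flipOn] at hL
    refine hL.trans ?_
    have hmeas : ∀ j : Fin n, Measurable fun z : Fin 2 × Fin p × Fin n → ℂ =>
        ‖∑ k, z (0, k, j) • colVec (B 0) k‖ₑ ^ (2 * q) := fun j => by fun_prop
    rw [secondEntries, Finset.sum_product, Finset.sum_singleton]
    calc _ = ∑ x : Fin p × Fin n, K * M * (‖colVec (B 1) x.1‖ₑ ^ (2 * q) *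
          ∫⁻ z, ‖∑ k, z (0, k, x.2) • colVec (B 0) k‖ₑ ^ (2 * q) ∂Measure.pi ν) := by
          refine Finset.sum_congr rfl fun x _ => ?_
          simp only [hb]
          rw [lintegral_const_mul _ ((hmeas _).const_mul _), lintegral_const_mul _ (hmeas _)]
      _ ≤ ∑ x : Fin p × Fin n, K * M * (‖colVec (B 1) x.1‖ₑ ^ (2 * q) * R) := by
          gcongr with x _; exact hR x.2
      _ = _ := by
          rw [← Finset.mul_sum, Fintype.sum_prod_type]
          simp only [Finset.sum_const, Finset.card_univ, Fintype.card_fin, nsmul_eq_mul]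
          rw [← Finset.mul_sum, ← Finset.sum_mul]
          ring
  · rintro ⟨k, i, j⟩ hx z
    obtain rfl : k = 1 := by simpa [secondEntries, eq_comm] using hx
    exact enorm_integral_resolventMean_update_sub_le s B (hint _) (h0 _) hq1 hq2 (hM _) z i j
  · rintro ⟨k, i, j⟩ - U hU z
    -- The bound involves only entries of `Z₁`, which reversals in `Z₂` leave alone.
    have : ∀ l : Fin p, flipOn U z (0, l, j) = z (0, l, j) := fun l => by
      have hl : ((0 : Fin 2), l, j) ∉ U := fun h => by simpa [secondEntries] using hU h
      simp [flipOn, hl]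
    simp only [hb, this]

/-- Both sides are the squared Frobenius norm of the Gram matrix; for `B = Σ^{1/2}` this is `tr Σ²`.
-/
theorem sum_norm_sq_colVec_and_inner (B : Matrix (Fin p) (Fin p) ℂ) :
    ∑ k, ∑ l, ‖inner ℂ (colVec B k) (colVec B l)‖ ^ 2 = (((Bᴴ * B) ^ 2).trace).re := by
  have hH : (Bᴴ * B)ᴴ = Bᴴ * B := by rw [conjTranspose_mul, conjTranspose_conjTranspose]
  rw [trace, Complex.re_sum]
  refine Finset.sum_congr rfl fun k _ => ?_
  rw [diag_apply, sq, mul_apply, Complex.re_sum]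
  refine Finset.sum_congr rfl fun l _ => ?_
  rw [inner_colVec]
  have : (Bᴴ * B) l k = star ((Bᴴ * B) k l) := by
    rw [← conjTranspose_apply, hH]
  rw [this, Complex.star_def, Complex.mul_conj, Complex.ofReal_re, Complex.normSq_eq_norm_sq]

theorem sum_norm_sq_colVec_sq_le (B : Matrix (Fin p) (Fin p) ℂ) :
    ∑ k, (‖colVec B k‖ ^ 2) ^ 2 ≤ (((Bᴴ * B) ^ 2).trace).re := by
  rw [← sum_norm_sq_colVec_and_inner]
  refine Finset.sum_le_sum fun k _ => ?_
  refine le_trans (le_of_eq ?_)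
    (Finset.single_le_sum (f := fun l => ‖inner ℂ (colVec B k) (colVec B l)‖ ^ 2)
    (fun _ _ => by positivity) (Finset.mem_univ k))
  rw [inner_self_eq_norm_sq_to_K]
  simp

/-- The inequality `y ^ q ≤ 1 + y ^ 2` reduces every exponent to the second spectral moment; no
operator norm bound is required. -/
theorem sum_norm_colVec_rpow_le (B : Matrix (Fin p) (Fin p) ℂ) {D : ℝ}
    (hD : (((Bᴴ * B) ^ 2).trace).re ≤ p * D) {q : ℝ} (hq1 : 1 ≤ q) (hq2 : q ≤ 2) :
    ∑ k, ‖colVec B k‖ ^ (2 * q) ≤ p * (1 + D) := by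
  have hy : ∀ y : ℝ, 0 ≤ y → y ^ q ≤ 1 + y ^ 2 := by
    intro y hy
    rcases le_total y 1 with h | h
    · have := Real.rpow_le_one hy h (by linarith : 0 ≤ q)
      nlinarith [sq_nonneg y]
    · have := Real.rpow_le_rpow_of_exponent_le h hq2
      norm_cast at this
      linarith
  calc ∑ k, ‖colVec B k‖ ^ (2 * q) ≤ ∑ k, (1 + (‖colVec B k‖ ^ 2) ^ 2) := by
        refine Finset.sum_le_sum fun k _ => ?_
        rw [Real.rpow_mul (norm_nonneg _)]
        refine (hy _ (by positivity)).trans (le_of_eq ?_)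
        norm_num
    _ = p + ∑ k, (‖colVec B k‖ ^ 2) ^ 2 := by rw [Finset.sum_add_distrib]; simp
    _ ≤ p + p * D := by gcongr; exact (sum_norm_sq_colVec_sq_le B).trans hD
    _ = _ := by ring

end Comparison

/-! ### A resolvent transform determines a probability measure on the line. -/

section Uniqueness

/-- The integral of `x ↦ (1 - i s x)⁻ᵏ`. -/
noncomputable def resolventPower (μ : Measure ℝ) (k : ℕ) (s : ℝ) : ℂ :=
  ∫ x, ((1 : ℂ) - ((s * x : ℝ) : ℂ) * Complex.I)⁻¹ ^ k ∂μ

theorem continuous_inv_one_sub_mul_I_pow (s : ℝ) (k : ℕ) :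
    Continuous fun x : ℝ => ((1 : ℂ) - ((s * x : ℝ) : ℂ) * Complex.I)⁻¹ ^ k :=
  (Continuous.inv₀ (by fun_prop) fun _ => one_sub_mul_I_ne_zero _).pow k

theorem norm_inv_one_sub_mul_I_pow_le (y : ℝ) (k : ℕ) :
    ‖((1 : ℂ) - (y : ℂ) * Complex.I)⁻¹ ^ k‖ ≤ 1 := by
  rw [norm_pow]
  exact pow_le_one₀ (norm_nonneg _) (norm_inv_one_sub_mul_I_le y)

theorem integrable_inv_one_sub_mul_I_pow (μ : Measure ℝ) [IsFiniteMeasure μ] (s : ℝ) (k : ℕ) :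
    Integrable (fun x : ℝ => ((1 : ℂ) - ((s * x : ℝ) : ℂ) * Complex.I)⁻¹ ^ k) μ :=
  Integrable.of_bound (continuous_inv_one_sub_mul_I_pow s k).aestronglyMeasurable 1
    (ae_of_all _ fun _ => norm_inv_one_sub_mul_I_pow_le _ k)

theorem abs_mul_norm_inv_one_sub_mul_I_le {s x : ℝ} (hs : s ≠ 0) :
    |x| * ‖((1 : ℂ) - ((s * x : ℝ) : ℂ) * Complex.I)⁻¹‖ ≤ |s|⁻¹ := by
  have h : |s * x| ≤ ‖(1 : ℂ) - ((s * x : ℝ) : ℂ) * Complex.I‖ := by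
    simpa [abs_mul] using Complex.abs_im_le_norm ((1 : ℂ) - ((s * x : ℝ) : ℂ) * Complex.I)
  have h0 : 0 < ‖(1 : ℂ) - ((s * x : ℝ) : ℂ) * Complex.I‖ :=
    norm_pos_iff.2 (one_sub_mul_I_ne_zero _)
  rw [norm_inv, ← div_eq_mul_inv, div_le_iff₀ h0, inv_mul_eq_div, le_div_iff₀ (abs_pos.2 hs),
    mul_comm, ← abs_mul]
  exact h

/-- Differentiation produces `i x (1 - i s x)⁻¹`, which equals `s⁻¹ ((1 - i s x)⁻¹ - 1)`. This is
bounded in `x` for `s ≠ 0`, so no moment of `μ` is needed. -/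
theorem hasDerivAt_resolventPower (μ : Measure ℝ) [IsFiniteMeasure μ] (k : ℕ) {s : ℝ}
    (hs : s ≠ 0) :
    HasDerivAt (resolventPower μ k)
      ((s : ℂ)⁻¹ * (k * (resolventPower μ (k + 1) s - resolventPower μ k s))) s := by
  set f : ℝ → ℝ → ℂ := fun s x => ((1 : ℂ) - ((s * x : ℝ) : ℂ) * Complex.I)⁻¹ ^ k
  set f' : ℝ → ℝ → ℂ := fun s x =>
    k * ((x : ℂ) * Complex.I * ((1 : ℂ) - ((s * x : ℝ) : ℂ) * Complex.I)⁻¹ ^ (k + 1)) with hf'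
  have hd : ∀ s x : ℝ, HasDerivAt (fun s => f s x) (f' s x) s := by
    intro s x
    have h1 : HasDerivAt (fun s : ℝ => (1 : ℂ) - ((s * x : ℝ) : ℂ) * Complex.I)
        (-((x : ℂ) * Complex.I)) s := by
      have := (((hasDerivAt_id s).mul_const x).ofReal_comp.mul_const Complex.I).const_sub (1 : ℂ)
      simpa using this
    have h2 := (h1.inv (one_sub_mul_I_ne_zero _)).pow k
    refine h2.congr_deriv ?_
    rw [hf']
    rcases Nat.eq_zero_or_pos k with rfl | hk
    · simp
    · obtain ⟨m, rfl⟩ : ∃ m, k = m + 1 := ⟨k - 1, by omega⟩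
      simp only [Nat.add_sub_cancel, Pi.inv_apply, div_eq_mul_inv, inv_pow]
      generalize (1 : ℂ) - ((s * x : ℝ) : ℂ) * Complex.I = u
      rw [show m + 1 + 1 = m + 2 from rfl, pow_add, mul_inv]
      ring
  -- Radius `|s| / 2` keeps away from zero and makes the dominating function constant.
  have hball : ∀ y ∈ Metric.ball s (|s| / 2), y ≠ 0 ∧ |y|⁻¹ ≤ 2 * |s|⁻¹ := by
    intro y hy
    have hs' := abs_pos.2 hs
    rw [Metric.mem_ball, Real.dist_eq] at hy
    have h1 : |s| - |y| ≤ |y - s| := by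
      have := abs_sub_abs_le_abs_sub s y
      rwa [abs_sub_comm] at this
    have h2 : |s| / 2 < |y| := by linarith
    refine ⟨abs_pos.1 (by linarith), ?_⟩
    calc |y|⁻¹ ≤ (|s| / 2)⁻¹ := inv_anti₀ (by positivity) h2.le
      _ = 2 * |s|⁻¹ := by rw [inv_div]; ring
  have key := (hasDerivAt_integral_of_dominated_loc_of_deriv_le (μ := μ) (F := f) (F' := f')
    (x₀ := s) (bound := fun _ => k * (2 * |s|⁻¹))
    (Metric.ball_mem_nhds s (half_pos (abs_pos.2 hs)))
    (Eventually.of_forall fun y => (continuous_inv_one_sub_mul_I_pow y k).aestronglyMeasurable)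
    (integrable_inv_one_sub_mul_I_pow μ s k)
    (by
      refine Continuous.aestronglyMeasurable ?_
      exact continuous_const.mul ((by fun_prop : Continuous fun x : ℝ => (x : ℂ) * Complex.I).mul
        (continuous_inv_one_sub_mul_I_pow s (k + 1))))
    (ae_of_all _ fun x y hy => by
      obtain ⟨hy0, hy1⟩ := hball y hy
      rw [hf', norm_mul, Complex.norm_natCast, norm_mul, norm_mul, Complex.norm_I, mul_one,
        Complex.norm_real, Real.norm_eq_abs, pow_succ', norm_mul, ← mul_assoc |x|]
      refine mul_le_mul_of_nonneg_left ?_ (Nat.cast_nonneg k)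
      calc _ ≤ |y|⁻¹ * 1 := mul_le_mul (abs_mul_norm_inv_one_sub_mul_I_le hy0)
            (norm_inv_one_sub_mul_I_pow_le _ k) (norm_nonneg _) (by positivity)
        _ ≤ _ := by rw [mul_one]; exact hy1)
    (integrable_const _)
    (ae_of_all _ fun x y _ => hd y x)).2
  refine key.congr_deriv ?_
  have hsc : (s : ℂ) ≠ 0 := by exact_mod_cast hs
  have e : ∀ x : ℝ, f' s x = (s : ℂ)⁻¹ * (k * (((1 : ℂ) - ((s * x : ℝ) : ℂ) * Complex.I)⁻¹ ^ (k + 1)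
      - ((1 : ℂ) - ((s * x : ℝ) : ℂ) * Complex.I)⁻¹ ^ k)) := by
    intro x
    have hne := one_sub_mul_I_ne_zero (s * x)
    have h1 : ((1 : ℂ) - ((s * x : ℝ) : ℂ) * Complex.I)⁻¹ ^ (k + 1)
        - ((1 : ℂ) - ((s * x : ℝ) : ℂ) * Complex.I)⁻¹ ^ k
        = (s : ℂ) * ((x : ℂ) * Complex.I * ((1 : ℂ) - ((s * x : ℝ) : ℂ) * Complex.I)⁻¹ ^ (k + 1)) := by
      rw [pow_succ]
      have h2 : ((s * x : ℝ) : ℂ) * Complex.I * ((1 : ℂ) - ((s * x : ℝ) : ℂ) * Complex.I)⁻¹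
          = ((1 : ℂ) - ((s * x : ℝ) : ℂ) * Complex.I)⁻¹ - 1 := by
        field_simp
        ring
      push_cast at h2 ⊢
      linear_combination (-((1 : ℂ) - (s * x : ℂ) * Complex.I)⁻¹ ^ k) * h2
    rw [h1, hf']
    field_simp
  simp_rw [e]
  rw [integral_const_mul, integral_const_mul, integral_sub
    (integrable_inv_one_sub_mul_I_pow μ s (k + 1)) (integrable_inv_one_sub_mul_I_pow μ s k)]
  rfl

/-- `(1 - i t x / k)⁻ᵏ → exp (i t x)` boundedly, so the powers of the resolvent recover the
characteristic function. -/
theorem tendsto_resolventPower_charFun (μ : Measure ℝ) [IsFiniteMeasure μ] (t : ℝ) :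
    Tendsto (fun k : ℕ => resolventPower μ k (t / k)) atTop (𝓝 (charFun μ t)) := by
  rw [charFun_apply_real]
  refine tendsto_integral_of_dominated_convergence (fun _ => 1)
    (fun k => (continuous_inv_one_sub_mul_I_pow _ k).aestronglyMeasurable) (integrable_const _)
    (fun k => ae_of_all _ fun x => norm_inv_one_sub_mul_I_pow_le _ k) (ae_of_all _ fun x => ?_)
  have h := (Complex.tendsto_one_add_div_pow_exp (-(t * x * Complex.I))).inv₀ (Complex.exp_ne_zero _)
  rw [← Complex.exp_neg, neg_neg] at h
  refine h.congr fun k => ?_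
  rw [inv_pow]
  congr 2
  push_cast
  ring

/-- A finite measure on `ℝ` is determined by its resolvent transform on the imaginary axis. -/
theorem ext_of_resolventPower_one {μ ν : Measure ℝ} [IsProbabilityMeasure μ]
    [IsProbabilityMeasure ν] (h : ∀ s, resolventPower μ 1 s = resolventPower ν 1 s) : μ = ν := by
  -- The derivative formula gives each power from the preceding one when `s ≠ 0`; at `s = 0` both
  -- sides are the total mass one.
  have hk : ∀ k s, resolventPower μ (k + 1) s = resolventPower ν (k + 1) s := by
    intro k
    induction k with
    | zero => exact h
    | succ k ih =>
      intro s
      rcases eq_or_ne s 0 with rfl | hs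
      · simp [resolventPower]
      · have h1 := hasDerivAt_resolventPower μ (k + 1) hs
        rw [funext ih] at h1
        have h2 := h1.unique (hasDerivAt_resolventPower ν (k + 1) hs)
        have hsc : (s : ℂ)⁻¹ ≠ 0 := inv_ne_zero (by exact_mod_cast hs)
        have hkc : ((k + 1 : ℕ) : ℂ) ≠ 0 := by exact_mod_cast Nat.succ_ne_zero k
        have h3 := mul_left_cancel₀ hkc (mul_left_cancel₀ hsc h2)
        exact sub_left_injective h3
  refine Measure.ext_of_charFun (funext fun t => ?_)
  refine tendsto_nhds_unique ((tendsto_add_atTop_iff_nat 1).2 (tendsto_resolventPower_charFun μ t)) ?_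
  simp_rw [hk]
  exact (tendsto_add_atTop_iff_nat 1).2 (tendsto_resolventPower_charFun ν t)

end Uniqueness

/-! ### Integrals against spectral distributions, and symmetry from an even transform. -/

section Spectral

variable {p : ℕ}

theorem integral_empiricalMeasure_map_univ {E : Type*} [MeasurableSpace E]
    [MeasurableSingletonClass E] (g : Fin p → E) (φ : E → ℂ) :
    ∫ x, φ x ∂(empiricalMeasure (Finset.univ.val.map g) : Measure E)
      = (p : ℂ)⁻¹ * ∑ i, φ (g i) := by
  have h : (empiricalMeasure (Finset.univ.val.map g) : Measure E)
      = ((p : ℝ≥0)⁻¹) • ∑ i, Measure.dirac (g i) := by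
    rw [empiricalMeasure, FiniteMeasure.toMeasure_smul, Multiset.card_map, Multiset.map_map]
    simp only [Finset.card_val, Finset.card_univ, Fintype.card_fin]
    congr 1
    exact map_sum FiniteMeasure.toMeasureAddMonoidHom
      (fun i => (diracProba (g i)).toFiniteMeasure) Finset.univ
  rw [h, integral_smul_nnreal_measure, integral_finsetSum_measure
    (fun i _ => integrable_dirac (by simp))]
  simp [NNReal.smul_def]

theorem integral_esd_of_skew {A : Matrix (Fin p) (Fin p) ℂ} (hA : Aᴴ = -A) (s : ℝ) :
    ∫ z, ((1 : ℂ) - ((s * z.im : ℝ) : ℂ) * Complex.I)⁻¹ ∂(esd A : Measure ℂ)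
      = (p : ℂ)⁻¹ * ((1 - (s : ℂ) • A)⁻¹).trace := by
  obtain ⟨d, hd, h⟩ := exists_roots_charpoly_of_skew hA
  rw [esd, hd, integral_empiricalMeasure_map_univ, h s]
  simp

theorem integral_esd_re_of_skew {A : Matrix (Fin p) (Fin p) ℂ} (hA : Aᴴ = -A) :
    ∫ z : ℂ, ((min 1 |z.re| : ℝ) : ℂ) ∂(esd A : Measure ℂ) = 0 := by
  obtain ⟨d, hd, h⟩ := exists_roots_charpoly_of_skew hA
  rw [esd, hd, integral_empiricalMeasure_map_univ]
  simp

/-- The test function `z ↦ (1 - i s Im z)⁻¹`. -/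
noncomputable def resolventBCF (s : ℝ) : BoundedContinuousFunction ℂ ℂ :=
  BoundedContinuousFunction.ofNormedAddCommGroup
    (fun z => ((1 : ℂ) - ((s * z.im : ℝ) : ℂ) * Complex.I)⁻¹)
    (Continuous.inv₀ (by fun_prop) fun _ => one_sub_mul_I_ne_zero _) 1
    fun _ => norm_inv_one_sub_mul_I_le _

/-- The test function `z ↦ min 1 |Re z|`. -/
noncomputable def reBCF : BoundedContinuousFunction ℂ ℂ :=
  BoundedContinuousFunction.ofNormedAddCommGroup (fun z => ((min 1 |z.re| : ℝ) : ℂ))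
    (by fun_prop) 1 fun z => by
      rw [Complex.norm_real, Real.norm_eq_abs, abs_of_nonneg (by positivity)]
      exact min_le_left _ _

/-- The integral of this test function passes to weak limits, so it transfers the imaginary-axis
support from the matrices to `F`. -/
theorem ae_re_eq_zero_of_integral (F : Measure ℂ) [IsFiniteMeasure F]
    (h : ∫ z : ℂ, ((min 1 |z.re| : ℝ) : ℂ) ∂F = 0) : ∀ᵐ z ∂F, z.re = 0 := by
  rw [integral_complex_ofReal, Complex.ofReal_eq_zero] at h
  have hint : Integrable (fun z : ℂ => min 1 |z.re|) F :=
    Integrable.of_bound (by fun_prop) 1 (ae_of_all _ fun z => by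
      rw [Real.norm_eq_abs, abs_of_nonneg (by positivity)]
      exact min_le_left _ _)
  have h2 := (integral_eq_zero_iff_of_nonneg (fun z => by positivity) hint).1 h
  filter_upwards [h2] with z hz
  simp only [Pi.zero_apply] at hz
  rcases min_choice (1 : ℝ) |z.re| with h1 | h1 <;> rw [h1] at hz
  · norm_num at hz
  · exact abs_eq_zero.1 hz

/-- A probability measure carried by the imaginary axis whose resolvent transform is even is
symmetric. -/
theorem map_neg_eq_of_resolvent_even (F : Measure ℂ) [IsProbabilityMeasure F]
    (hre : ∀ᵐ z ∂F, z.re = 0)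
    (h : ∀ s : ℝ, ∫ z, ((1 : ℂ) - ((s * z.im : ℝ) : ℂ) * Complex.I)⁻¹ ∂F
      = ∫ z, ((1 : ℂ) - ((-s * z.im : ℝ) : ℂ) * Complex.I)⁻¹ ∂F) :
    F.map (fun z => -z) = F := by
  have hcont : ∀ s : ℝ, Continuous fun x : ℝ => ((1 : ℂ) - ((s * x : ℝ) : ℂ) * Complex.I)⁻¹ ^ 1 :=
    fun s => continuous_inv_one_sub_mul_I_pow s 1
  have him : Measurable Complex.im := Complex.measurable_im
  have hp1 : IsProbabilityMeasure (F.map Complex.im) :=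
    Measure.isProbabilityMeasure_map him.aemeasurable
  have hp2 : IsProbabilityMeasure ((F.map Complex.im).map fun y => -y) :=
    Measure.isProbabilityMeasure_map measurable_neg.aemeasurable
  have hsym : (F.map Complex.im).map (fun y => -y) = F.map Complex.im := by
    refine ext_of_resolventPower_one fun s => ?_
    have hneg : Continuous fun x : ℝ => ((1 : ℂ) - ((s * -x : ℝ) : ℂ) * Complex.I)⁻¹ ^ 1 :=
      (hcont s).comp continuous_neg
    rw [resolventPower, resolventPower, integral_map measurable_neg.aemeasurable
      (hcont s).aestronglyMeasurable, integral_map him.aemeasurable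
      ((hcont s).aestronglyMeasurable), integral_map him.aemeasurable
      hneg.aestronglyMeasurable]
    simp only [pow_one]
    rw [h s]
    simp
  have hF : (F.map Complex.im).map (fun y : ℝ => (y : ℂ) * Complex.I) = F := by
    rw [Measure.map_map (by fun_prop) him]
    have e : ((fun y : ℝ => (y : ℂ) * Complex.I) ∘ Complex.im) =ᵐ[F] id := by
      filter_upwards [hre] with z hz
      apply Complex.ext <;> simp [hz]
    rw [Measure.map_congr e, Measure.map_id]
  calc F.map (fun z => -z)
      = ((F.map Complex.im).map (fun y : ℝ => (y : ℂ) * Complex.I)).map (fun z => -z) := by rw [hF]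
    _ = ((F.map Complex.im).map (fun y => -y)).map (fun y : ℝ => (y : ℂ) * Complex.I) := by
        rw [Measure.map_map measurable_neg (by fun_prop),
          Measure.map_map (by fun_prop) measurable_neg]
        congr 1
        funext y
        simp
    _ = F := by rw [hsym, hF]

end Spectral

/-! ### Measurability of the positive semi-definite square root. -/

section SquareRoot

open Matrix
open scoped MatrixOrder

variable {p : ℕ}

theorem psdSqrt_isHermitian (A : Matrix (Fin p) (Fin p) ℂ) : (psdSqrt A)ᴴ = psdSqrt A :=
  (CFC.sqrt_nonneg A).posSemidef.isHermitian

theorem psdSqrt_conjTranspose_mul_self {A : Matrix (Fin p) (Fin p) ℂ} (hA : A.PosSemidef) :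
    (psdSqrt A)ᴴ * psdSqrt A = A := by
  rw [psdSqrt_isHermitian]
  exact CFC.sqrt_mul_sqrt_self A hA.nonneg

open scoped Matrix.Norms.L2Operator in
theorem isClosed_setOf_posSemidef_and_continuousOn_psdSqrt :
    IsClosed {A : Matrix (Fin p) (Fin p) ℂ | A.PosSemidef} ∧
      ContinuousOn psdSqrt {A : Matrix (Fin p) (Fin p) ℂ | A.PosSemidef} := by
  have e : {A : Matrix (Fin p) (Fin p) ℂ | A.PosSemidef} = {A | 0 ≤ A} := by
    ext A; exact nonneg_iff_posSemidef.symm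
  rw [e]
  exact ⟨isClosed_le continuous_const continuous_id, CFC.continuousOn_sqrt⟩

theorem continuous_entriesMatrix {m n : ℕ} (k : Fin 2) :
    Continuous fun b : Fin 2 × Fin m × Fin n → ℂ => entriesMatrix b k :=
  continuous_matrix fun i j => by simp only [entriesMatrix, of_apply]; fun_prop

/-- The square root of positive semi-definite matrices is Borel measurable in the entries. -/
theorem exists_measurable_psdSqrt (p : ℕ) :
    ∃ g : (Fin 2 × Fin p × Fin p → ℂ) → (Fin 2 × Fin p × Fin p → ℂ), Measurable g ∧
      ∀ b, (∀ k, (entriesMatrix b k).PosSemidef) →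
        entriesMatrix (g b) = fun k => psdSqrt (entriesMatrix b k) := by
  classical
  obtain ⟨hcl, hco⟩ := isClosed_setOf_posSemidef_and_continuousOn_psdSqrt (p := p)
  set P : Set (Fin 2 × Fin p × Fin p → ℂ) := {b | ∀ k, (entriesMatrix b k).PosSemidef}
  have hP : IsClosed P := by
    have : P = ⋂ k, (fun b => entriesMatrix b k) ⁻¹' {A | A.PosSemidef} := by
      ext b; simp [P]
    rw [this]
    exact isClosed_iInter fun k => hcl.preimage (continuous_entriesMatrix k)
  set h : (Fin 2 × Fin p × Fin p → ℂ) → (Fin 2 × Fin p × Fin p → ℂ) :=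
    fun b x => psdSqrt (entriesMatrix b x.1) x.2.1 x.2.2
  have hh : ContinuousOn h P := by
    refine continuousOn_pi.2 fun x => ?_
    have h1 : ContinuousOn (fun b => psdSqrt (entriesMatrix b x.1)) P :=
      hco.comp (continuous_entriesMatrix x.1).continuousOn fun b hb => hb x.1
    exact (continuous_id.matrix_elem x.2.1 x.2.2).comp_continuousOn h1
  -- The square root is continuous on the closed set `P`; the value 0 off `P` is arbitrary.
  refine ⟨P.piecewise h 0, hh.measurable_piecewise continuousOn_const hP.measurableSet,
    fun b hb => ?_⟩
  rw [Set.piecewise_eq_of_mem _ _ _ (show b ∈ P from hb)]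
  rfl

end SquareRoot

/-! ### Asymptotics of the error, conditioning, and the conclusion. -/

/-- The bound for the effect of replacing `Z₂` by `-Z₂`. -/
noncomputable def flipBound (p n : ℕ) (s q D : ℝ) (M : ℝ≥0∞) : ℝ≥0∞ :=
  ENNReal.ofReal ((p : ℝ)⁻¹ * 2 * (2 * |s| / n) ^ (2 * q)) * M * ENNReal.ofReal (p * (1 + D))
    * (n * (2 ^ (q - 1) * (M + 2 ^ q) * ENNReal.ofReal (p * (1 + D)) ^ q))

/-- Power counting: `p⁻¹ · n^(-2q) · p · n · p^q = (p/n)^q n^(1-q)`. This is where a moment of order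
above two is used. -/
theorem tendsto_flipBound {p : ℕ → ℕ} {c : ℝ} (hc : 0 < c)
    (hp : Tendsto (fun n : ℕ => (p n : ℝ) / (n : ℝ)) atTop (𝓝 c)) (s : ℝ) {q D : ℝ} (hq : 1 < q)
    (hD : 0 ≤ D) {M : ℝ≥0∞} (hM : M ≠ ∞) :
    Tendsto (fun n => flipBound (p n) n s q D M) atTop (𝓝 0) := by
  have hq0 : 0 ≤ q := by linarith
  set C : ℝ := 2 * (2 * |s|) ^ (2 * q) * (1 + D) ^ (1 + q)
  set K : ℝ≥0∞ := M * (2 ^ (q - 1) * (M + 2 ^ q)) with hK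
  have hKtop : K ≠ ∞ := by
    rw [hK]
    have : (2 : ℝ≥0∞) ^ (q - 1) ≠ ∞ := by finiteness
    have : (2 : ℝ≥0∞) ^ q ≠ ∞ := by finiteness
    finiteness
  have hreal : Tendsto (fun n : ℕ => C * (((p n : ℝ) / n) ^ q * (n : ℝ) ^ (-(q - 1)))) atTop
      (𝓝 0) := by
    have h1 := hp.rpow_const (p := q) (Or.inl hc.ne')
    have h2 := (tendsto_rpow_neg_atTop (by linarith : 0 < q - 1)).comp
      (tendsto_natCast_atTop_atTop (R := ℝ))
    simpa using (h1.mul h2).const_mul C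
  have hlim : Tendsto (fun n : ℕ => K * ENNReal.ofReal
      (C * (((p n : ℝ) / n) ^ q * (n : ℝ) ^ (-(q - 1))))) atTop (𝓝 0) := by
    have := ENNReal.Tendsto.const_mul (a := K) (ENNReal.tendsto_ofReal hreal) (Or.inr hKtop)
    simpa using this
  refine hlim.congr' ?_
  filter_upwards [hp.eventually_const_lt hc, eventually_gt_atTop 0] with n hpn hn
  have hn' : (0 : ℝ) < n := by exact_mod_cast hn
  have hp' : (0 : ℝ) < p n := by
    rcases (Nat.cast_nonneg (α := ℝ) (p n)).eq_or_lt with h | h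
    · rw [← h, zero_div] at hpn; exact absurd hpn (lt_irrefl _)
    · exact h
  have e : C * (((p n : ℝ) / n) ^ q * (n : ℝ) ^ (-(q - 1)))
      = ((p n : ℝ)⁻¹ * 2 * (2 * |s| / n) ^ (2 * q)) * (p n * (1 + D)) * n * (p n * (1 + D)) ^ q := by
    have hD1 : 0 < 1 + D := by linarith
    rw [Real.div_rpow hp'.le hn'.le, Real.div_rpow (by positivity) hn'.le,
      Real.mul_rpow hp'.le hD1.le, Real.rpow_neg hn'.le, Real.rpow_sub_one hn'.ne', two_mul q,
      Real.rpow_add hn' q q]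
    simp only [C]
    rw [Real.rpow_add hD1, Real.rpow_one, two_mul q]
    field_simp
  rw [e, flipBound, hK, ENNReal.ofReal_mul (by positivity), ENNReal.ofReal_mul (by positivity),
    ENNReal.ofReal_mul (p := (p n : ℝ)⁻¹ * 2 * (2 * |s| / n) ^ (2 * q)) (by positivity),
    ENNReal.ofReal_natCast, ENNReal.ofReal_rpow_of_nonneg (by positivity) hq0]
  ring

theorem enorm_rpow_le_one_add {x : ℝ≥0∞} {a b : ℝ} (ha : 0 ≤ a) (hab : a ≤ b) :
    x ^ a ≤ 1 + x ^ b := by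
  rcases le_total x 1 with h | h
  · exact (ENNReal.rpow_le_one h ha).trans le_self_add
  · exact (ENNReal.rpow_le_rpow_of_exponent_le h hab).trans le_add_self

open Matrix in
/-- For fixed scaling matrices with bounded spectral second moment, the resolvent mean is even in
`s` up to a small error. -/
theorem enorm_integral_resolventMean_sub_le_flipBound {Ω : Type*} [MeasurableSpace Ω]
    {μ : Measure Ω} [IsProbabilityMeasure μ] {p n : ℕ} {Z : Fin 2 × Fin p × Fin n → Ω → ℂ}
    (hm : ∀ x, Measurable (Z x)) (hind : iIndepFun Z μ) (h0 : ∀ x, ∫ ω, Z x ω ∂μ = 0)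
    (h1 : ∀ x, ∫ ω, ‖Z x ω‖ ^ 2 ∂μ = 1) {q : ℝ} (hq1 : 1 ≤ q) (hq2 : q ≤ 3 / 2) {M : ℝ≥0∞}
    (hM : ∀ x, ∫⁻ ω, ‖Z x ω‖ₑ ^ (2 * q) ∂μ ≤ M) (s : ℝ) (hp : 0 < p) {D : ℝ} (hD : 0 ≤ D)
    {B : Fin 2 → Matrix (Fin p) (Fin p) ℂ}
    (hB : ∀ k, ((((B k)ᴴ * B k) ^ 2).trace).re ≤ p * D) :
    ‖∫ z, (resolventMean s B (entriesMatrix z) - resolventMean (-s) B (entriesMatrix z))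
      ∂Measure.pi (fun x => μ.map (Z x))‖ₑ ≤ flipBound p n s q D M := by
  -- Without square integrability the integral in `h1` would take the default value 0 instead of 1.
  have hL2 : ∀ x, MemLp (Z x) 2 μ := fun x => by
    rw [memLp_two_iff_integrable_sq_norm (hm x).aestronglyMeasurable]
    by_contra h
    have := h1 x
    rw [integral_undef h] at this
    exact zero_ne_one this
  have hprob : ∀ x, IsProbabilityMeasure (μ.map (Z x)) := fun x =>
    Measure.isProbabilityMeasure_map (hm x).aemeasurable
  have hp1 : (1 : ℝ) ≤ p := by exact_mod_cast hp
  have hpow : ∀ k, ∑ i, ‖colVec (B k) i‖ ^ (2 * q) ≤ p * (1 + D) := fun k =>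
    sum_norm_colVec_rpow_le (B k) (hB k) hq1 (by linarith)
  have hsq : ∑ i, ‖colVec (B 0) i‖ ^ 2 ≤ p * (1 + D) := by
    have := sum_norm_colVec_rpow_le (B 0) (hB 0) le_rfl one_le_two
    simpa using this
  have hmain := enorm_integral_resolventMean_sub_le s B (fun x => μ.map (Z x)) ?_ ?_ hq1 hq2
    (M := M) (R := 2 ^ (q - 1) * (M + 2 ^ q) * ENNReal.ofReal (p * (1 + D)) ^ q) ?_ ?_
  · refine hmain.trans ?_
    rw [flipBound]
    gcongr
    refine le_trans (le_of_eq ?_) (ENNReal.ofReal_le_ofReal (hpow 1))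
    rw [ENNReal.ofReal_sum_of_nonneg (fun _ _ => by positivity)]
    refine Finset.sum_congr rfl fun i _ => ?_
    rw [← ENNReal.ofReal_rpow_of_nonneg (norm_nonneg _) (by linarith), ofReal_norm]
  · intro x
    exact (integrable_map_measure (by fun_prop) (hm x).aemeasurable).2
      ((hL2 x).integrable one_le_two)
  · intro x
    rw [integral_map (hm x).aemeasurable (by fun_prop)]
    exact h0 x
  · intro x
    rw [lintegral_map (by fun_prop) (hm x)]
    exact hM x
  · intro j
    rw [← hind.map_fun_eq_pi_map (fun x => (hm x).aemeasurable),
      lintegral_map (by fun_prop) (measurable_pi_lambda _ hm)]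
    refine lintegral_enorm_sum_smul_rpow_le (z := fun k => Z (0, k, j)) (fun k => hm _)
      (hind.precomp (g := fun k : Fin p => ((0 : Fin 2), k, j)) fun a b hab => by simpa using hab)
      (fun k => hL2 _) (fun k => h0 _) (fun k => h1 _) hq1 (by linarith) (fun k => hM _)
      (fun k => colVec (B 0) k) Finset.univ (by positivity) hsq ?_
    rw [sum_norm_sq_colVec_and_inner]
    -- With `V = p (1 + D)` and `p ≥ 1`, the bound `p D` is below `V ^ 2`.
    refine (hB 0).trans ?_
    nlinarith [mul_nonneg (by linarith : (0 : ℝ) ≤ p) hD, mul_nonneg hD hD,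
      mul_le_mul hp1 hp1 zero_le_one (by linarith), mul_nonneg (sub_nonneg.2 hp1) hD]

/-- Fubini under independence: `X` is frozen and `Y` averaged first, which reduces random scaling
matrices to fixed ones. -/
theorem enorm_integral_le_of_indepFun {Ω α β : Type*} [MeasurableSpace Ω] [MeasurableSpace α]
    [MeasurableSpace β] {μ : Measure Ω} [IsProbabilityMeasure μ] {X : Ω → α} {Y : Ω → β}
    (hX : Measurable X) (hY : Measurable Y) (hXY : IndepFun X Y μ) {Ψ : α × β → ℂ}
    (hΨ : Measurable Ψ) {C : ℝ} (hC : ∀ q, ‖Ψ q‖ ≤ C) :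
    ‖∫ ω, Ψ (X ω, Y ω) ∂μ‖ₑ ≤ ∫⁻ ω, ‖∫ y, Ψ (X ω, y) ∂(μ.map Y)‖ₑ ∂μ := by
  have hpX : IsProbabilityMeasure (μ.map X) := Measure.isProbabilityMeasure_map hX.aemeasurable
  have hpY : IsProbabilityMeasure (μ.map Y) := Measure.isProbabilityMeasure_map hY.aemeasurable
  have h := (indepFun_iff_map_prod_eq_prod_map_map hX.aemeasurable hY.aemeasurable).1 hXY
  have hmeas : Measurable fun x => ∫ y, Ψ (x, y) ∂(μ.map Y) :=
    (hΨ.stronglyMeasurable.integral_prod_right').measurable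
  rw [← integral_map (φ := fun ω => (X ω, Y ω)) (hX.prodMk hY).aemeasurable
    hΨ.aestronglyMeasurable, h, integral_prod _ (Integrable.of_bound hΨ.aestronglyMeasurable C
      (ae_of_all _ hC))]
  refine (enorm_integral_le_lintegral_enorm _).trans ?_
  rw [lintegral_map hmeas.enorm hX]

end RandomCommutator

theorem theorem4p5 {Ω : Type*} [MeasurableSpace Ω] (μ : Measure Ω) [IsProbabilityMeasure μ]
    -- the dimension `p n`; at stage `n` the `k`-th scaling matrix is `S n ω k`,
    -- and the `k`-th innovation matrix is `Z n ω k`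
    (p : ℕ → ℕ) (c : ℝ)
    (S : (n : ℕ) → Ω → Fin 2 → Matrix (Fin (p n)) (Fin (p n)) ℂ)
    (Z : (n : ℕ) → Ω → Fin 2 → Matrix (Fin (p n)) (Fin n) ℂ)
    (hSmeas : ∀ n k i j, Measurable fun ω => S n ω k i j)
    (hZmeas : ∀ n k i j, Measurable fun ω => Z n ω k i j)
    -- the scaling matrices are positive semi-definite and independent of the innovations
    (hSpsd : ∀ n, ∀ᵐ ω ∂μ, ∀ k, (S n ω k).PosSemidef)
    (hSZ : ∀ n, IndepFun
      (fun ω (x : Fin 2 × Fin (p n) × Fin (p n)) => S n ω x.1 x.2.1 x.2.2)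
      (fun ω (x : Fin 2 × Fin (p n) × Fin n) => Z n ω x.1 x.2.1 x.2.2) μ)
    -- `p / n` converges to `c` in `(0, ∞)`
    (hc : 0 < c)
    (hT1 : Tendsto (fun n : ℕ => (p n : ℝ) / (n : ℝ)) atTop (𝓝 c))
    -- independent entries, zero mean, unit variance, uniformly bounded moment of order `2 + η₀`
    (hT2indep : ∀ n, iIndepFun
      (fun (x : Fin 2 × Fin (p n) × Fin n) ω => Z n ω x.1 x.2.1 x.2.2) μ)
    (hT2mean : ∀ n k i j, ∫ ω, Z n ω k i j ∂μ = 0)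
    (hT2var : ∀ n k i j, ∫ ω, ‖Z n ω k i j‖ ^ 2 ∂μ = 1)
    (η₀ : ℝ) (hη₀ : 0 < η₀)
    (hT2mom : (⨆ (n) (k) (i) (j), ∫⁻ ω, ‖Z n ω k i j‖ₑ ^ (2 + η₀) ∂μ) < ∞)
    -- the scaling matrices commute
    (hT3 : ∀ n, ∀ᵐ ω ∂μ, S n ω 0 * S n ω 1 = S n ω 1 * S n ω 0)
    -- the joint spectral distributions converge weakly a.s. to a non-random `H` on the closed
    -- quadrant, whose support is contained in neither of the two coordinate axes
    (H : ProbabilityMeasure (ℝ × ℝ))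
    (hHquad : (H : Measure (ℝ × ℝ)) {x | 0 ≤ x.1 ∧ 0 ≤ x.2}ᶜ = 0)
    (hHfst : (H : Measure (ℝ × ℝ)) {x | x.1 ≠ 0} ≠ 0)
    (hHsnd : (H : Measure (ℝ × ℝ)) {x | x.2 ≠ 0} ≠ 0)
    (hT4 : ∀ᵐ ω ∂μ, Tendsto (fun n => RandomCommutator.jesd (S n ω 0) (S n ω 1)) atTop
      (𝓝 H.toFiniteMeasure))
    -- bounded second spectral moments; the limsup is taken in the extended reals
    (D₀ : ℝ) (hD₀ : 0 < D₀)
    (hT5 : ∀ᵐ ω ∂μ, ∀ k,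
      limsup (fun n => (((p n : ℝ)⁻¹ * ((S n ω k) ^ 2).trace.re : ℝ) : EReal)) atTop
        < (D₀ : EReal))
    -- `F` is the limiting spectral distribution of the commutator matrices
    (F : ProbabilityMeasure ℂ)
    (hF : RandomCommutator.IsLSD μ
      (fun n ω => RandomCommutator.commutatorMatrix (S n ω) (Z n ω)) F) :
    -- `F` is invariant under the reflection `z ↦ -z`
    (F : Measure ℂ).map (fun z => -z) = (F : Measure ℂ) := by


  choose g hg hgS using RandomCommutator.exists_measurable_psdSqrt
  -- The moment order is `2 q = 2 + min η₀ 1`, capped at 3, the order of the remainder. The extra 1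
  -- in `M` below pays for lowering the exponent from `2 + η₀`.
  set q : ℝ := 1 + min η₀ 1 / 2 with hq
  have hmin : 0 < min η₀ 1 := lt_min hη₀ one_pos
  have hq1 : 1 < q := by linarith
  have hq2 : q ≤ 3 / 2 := by linarith [min_le_right η₀ 1]
  set M : ℝ≥0∞ := 1 + ⨆ (n) (k) (i) (j), ∫⁻ ω, ‖Z n ω k i j‖ₑ ^ (2 + η₀) ∂μ with hMdef
  have hMtop : M ≠ ∞ := by rw [hMdef]; finiteness
  let Sf : (n : ℕ) → Ω → (Fin 2 × Fin (p n) × Fin (p n) → ℂ) :=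
    fun n ω x => S n ω x.1 x.2.1 x.2.2
  let Zf : (n : ℕ) → Ω → (Fin 2 × Fin (p n) × Fin n → ℂ) := fun n ω x => Z n ω x.1 x.2.1 x.2.2
  have hSfm : ∀ n, Measurable (Sf n) := fun n => measurable_pi_lambda _ fun x => hSmeas n _ _ _
  have hZfm : ∀ n, Measurable (Zf n) := fun n => measurable_pi_lambda _ fun x => hZmeas n _ _ _
  -- An everywhere measurable version of the square roots, equal to them almost surely and still
  -- independent of the innovations.
  let b : (n : ℕ) → Ω → (Fin 2 × Fin (p n) × Fin (p n) → ℂ) := fun n ω => g (p n) (Sf n ω)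
  have hbm : ∀ n, Measurable (b n) := fun n => (hg (p n)).comp (hSfm n)
  have hind : ∀ n, IndepFun (b n) (Zf n) μ := fun n => (hSZ n).comp (hg (p n)) measurable_id
  have hM : ∀ n x, ∫⁻ ω, ‖Zf n ω x‖ₑ ^ (2 * q) ∂μ ≤ M := by
    intro n x
    calc ∫⁻ ω, ‖Zf n ω x‖ₑ ^ (2 * q) ∂μ ≤ ∫⁻ ω, (1 + ‖Zf n ω x‖ₑ ^ (2 + η₀)) ∂μ :=
          lintegral_mono fun ω => RandomCommutator.enorm_rpow_le_one_add (by linarith)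
            (by linarith [min_le_left η₀ 1])
      _ = 1 + ∫⁻ ω, ‖Z n ω x.1 x.2.1 x.2.2‖ₑ ^ (2 + η₀) ∂μ := by
          rw [lintegral_add_left measurable_const]; simp [Zf]
      _ ≤ M := by
          rw [hMdef]
          gcongr
          exact le_iSup_of_le n (le_iSup_of_le x.1 (le_iSup_of_le x.2.1
            (le_iSup (fun j => ∫⁻ ω, ‖Z n ω x.1 x.2.1 j‖ₑ ^ (2 + η₀) ∂μ) x.2.2)))
  let m : ℝ → (n : ℕ) → Ω → ℂ := fun s n ω => RandomCommutator.resolventMean s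
    (RandomCommutator.entriesMatrix (b n ω)) (RandomCommutator.entriesMatrix (Zf n ω))
  have hmm : ∀ s n, Measurable (m s n) := fun s n => by
    have h := (RandomCommutator.continuous_resolventMean s).measurable.comp
      (f := fun ω => (b n ω, Zf n ω)) ((hbm n).prodMk (hZfm n))
    exact h
  have hm1 : ∀ s n ω, ‖m s n ω‖ ≤ 1 := fun s n ω => RandomCommutator.norm_resolventMean_le _ _ _
  have hbS : ∀ᵐ ω ∂μ, ∀ n, (∀ k, (S n ω k).PosSemidef) ∧
      RandomCommutator.entriesMatrix (b n ω) = fun k => RandomCommutator.psdSqrt (S n ω k) := by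
    filter_upwards [ae_all_iff.2 hSpsd] with ω hω n
    exact ⟨hω n, hgS (p n) (Sf n ω) (hω n)⟩
  have hskew : ∀ n ω, (RandomCommutator.commutatorMatrix (S n ω) (Z n ω))ᴴ
      = -RandomCommutator.commutatorMatrix (S n ω) (Z n ω) := fun n ω =>
    RandomCommutator.scaledCommutator_skew (fun k => RandomCommutator.psdSqrt (S n ω k)) (Z n ω)
  have hlim : ∀ s : ℝ, Tendsto (fun n => ∫ ω, m s n ω ∂μ) atTop
      (𝓝 (∫ z, ((1 : ℂ) - ((s * z.im : ℝ) : ℂ) * Complex.I)⁻¹ ∂(F : Measure ℂ))) := by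
    intro s
    have hconst : ∫ _ : Ω, (∫ z, ((1 : ℂ) - ((s * z.im : ℝ) : ℂ) * Complex.I)⁻¹ ∂(F : Measure ℂ)) ∂μ
        = ∫ z, ((1 : ℂ) - ((s * z.im : ℝ) : ℂ) * Complex.I)⁻¹ ∂(F : Measure ℂ) := by simp
    rw [← hconst]
    refine tendsto_integral_of_dominated_convergence (fun _ => 1)
      (fun n => (hmm s n).aestronglyMeasurable) (integrable_const _)
      (fun n => ae_of_all _ (hm1 s n)) ?_
    filter_upwards [hF, hbS] with ω hω hb
    have h := (FiniteMeasure.tendsto_iff_forall_integral_rclike_tendsto ℂ).1 hω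
      (RandomCommutator.resolventBCF s)
    refine h.congr fun n => ?_
    simp only [m, (hb n).2]
    exact RandomCommutator.integral_esd_of_skew (hskew n ω) s
  have hFre : ∀ᵐ z ∂(F : Measure ℂ), z.re = 0 := by
    refine RandomCommutator.ae_re_eq_zero_of_integral _ ?_
    -- As `F` is non-random, a single outcome suffices.
    obtain ⟨ω, hω⟩ := hF.exists
    have h := (FiniteMeasure.tendsto_iff_forall_integral_rclike_tendsto ℂ).1 hω
      RandomCommutator.reBCF
    refine tendsto_nhds_unique (h.congr fun n => ?_) tendsto_const_nhds
    exact RandomCommutator.integral_esd_re_of_skew (hskew n ω)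
  refine RandomCommutator.map_neg_eq_of_resolvent_even _ hFre fun s => ?_
  have hdiff : Tendsto (fun n => ∫ ω, (m s n ω - m (-s) n ω) ∂μ) atTop (𝓝 0) := by
    rw [tendsto_zero_iff_enorm_tendsto_zero]
    let Ψ : (n : ℕ) → (Fin 2 × Fin (p n) × Fin (p n) → ℂ) × (Fin 2 × Fin (p n) × Fin n → ℂ) → ℂ :=
      fun n x => RandomCommutator.resolventMean s (RandomCommutator.entriesMatrix x.1)
          (RandomCommutator.entriesMatrix x.2)
        - RandomCommutator.resolventMean (-s) (RandomCommutator.entriesMatrix x.1)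
          (RandomCommutator.entriesMatrix x.2)
    have hΨm : ∀ n, Measurable (Ψ n) := fun n =>
      (RandomCommutator.continuous_resolventMean s).measurable.sub
        (RandomCommutator.continuous_resolventMean (-s)).measurable
    have hΨ2 : ∀ n x, ‖Ψ n x‖ ≤ 2 := fun n x => (norm_sub_le _ _).trans (by
      have := RandomCommutator.norm_resolventMean_le s (RandomCommutator.entriesMatrix x.1)
          (RandomCommutator.entriesMatrix x.2)
      have := RandomCommutator.norm_resolventMean_le (-s) (RandomCommutator.entriesMatrix x.1)
          (RandomCommutator.entriesMatrix x.2)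
      linarith)
    have hprob : ∀ n, IsProbabilityMeasure (μ.map (Zf n)) := fun n =>
      Measure.isProbabilityMeasure_map (hZfm n).aemeasurable
    refine tendsto_of_tendsto_of_tendsto_of_le_of_le tendsto_const_nhds ?_ (fun n => zero_le)
      (fun n => RandomCommutator.enorm_integral_le_of_indepFun (hbm n) (hZfm n) (hind n) (hΨm n)
        (hΨ2 n))
    have hinner : ∀ n, Measurable fun ω => ‖∫ y, Ψ n (b n ω, y) ∂(μ.map (Zf n))‖ₑ := fun n =>
      (((hΨm n).stronglyMeasurable.integral_prod_right').measurable.comp (hbm n)).enorm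
    have h0 : ∫⁻ _ : Ω, 0 ∂μ = 0 := lintegral_zero
    rw [← h0]
    -- The trace bound holds only from some `n` on that depends on `ω`, so the conditional error is
    -- bounded pointwise and then integrated by dominated convergence.
    refine tendsto_lintegral_of_dominated_convergence (fun _ => 2) hinner
      (fun n => ae_of_all _ fun ω => ?_) (by simp) ?_
    · have h := norm_integral_le_of_norm_le_const (μ := μ.map (Zf n))
        (ae_of_all _ fun y => hΨ2 n (b n ω, y))
      rw [probReal_univ, mul_one] at h
      beta_reduce
      rw [← ofReal_norm]
      exact (ENNReal.ofReal_le_ofReal h).trans (by simp)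
    · filter_upwards [hT5, hbS] with ω hω hb
      refine tendsto_of_tendsto_of_tendsto_of_le_of_le' tendsto_const_nhds
        (RandomCommutator.tendsto_flipBound hc hT1 s hq1 hD₀.le hMtop)
        (Eventually.of_forall fun n => zero_le) ?_
      have htr : ∀ᶠ n in atTop, ∀ k, (p n : ℝ)⁻¹ * ((S n ω k) ^ 2).trace.re < D₀ := by
        refine eventually_all.2 fun k => ?_
        filter_upwards [eventually_lt_of_limsup_lt (hω k)] with n hn
        exact_mod_cast hn
      filter_upwards [htr, hT1.eventually_const_lt hc] with n hn hpn
      have hp : 0 < p n := by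
        rcases Nat.eq_zero_or_pos (p n) with h | h
        · rw [h, Nat.cast_zero, zero_div] at hpn; exact absurd hpn (lt_irrefl _)
        · exact h
      have hp' : (0 : ℝ) < p n := by exact_mod_cast hp
      have hpi : μ.map (Zf n) = Measure.pi fun x => μ.map (fun ω => Zf n ω x) := by
        have h := (hT2indep n).map_fun_eq_pi_map fun x => (hZmeas n _ _ _).aemeasurable
        exact h
      rw [hpi]
      have hB : ∀ k, ((((RandomCommutator.entriesMatrix (b n ω) k)ᴴ
          * RandomCommutator.entriesMatrix (b n ω) k) ^ 2).trace).re ≤ p n * D₀ := by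
        intro k
        rw [(hb n).2]
        simp only [RandomCommutator.psdSqrt_conjTranspose_mul_self ((hb n).1 k)]
        have h := hn k
        rw [inv_mul_lt_iff₀ hp'] at h
        exact h.le
      have h := RandomCommutator.enorm_integral_resolventMean_sub_le_flipBound
        (Z := fun x ω => Zf n ω x) (fun x => hZmeas n _ _ _) (hT2indep n)
        (fun x => hT2mean n _ _ _) (fun x => hT2var n _ _ _) hq1.le hq2 (hM n) s hp hD₀.le hB
      exact h
  have hsub : ∀ n, ∫ ω, (m s n ω - m (-s) n ω) ∂μ = ∫ ω, m s n ω ∂μ - ∫ ω, m (-s) n ω ∂μ :=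
    fun n => integral_sub
      (Integrable.of_bound (hmm s n).aestronglyMeasurable 1 (ae_of_all _ (hm1 s n)))
      (Integrable.of_bound (hmm (-s) n).aestronglyMeasurable 1 (ae_of_all _ (hm1 (-s) n)))
  simp_rw [hsub] at hdiff
  exact sub_eq_zero.1 (tendsto_nhds_unique ((hlim s).sub (hlim (-s))) hdiff)
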